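/- **Notation.** For $\ell\ge 0$ let $\mathcal P_\ell(\mathbb R^d)$ be the set of Borel probability measures $m$ on $\mathbb R^d$ with $\int|x|^\ell\,m(dx)<\infty$, with the $\sigma$-algebra generated by the maps $m\mapsto m(A)$, $A$ Borel. For $\ell>0$ let $W_\ell(\mu,\nu)=\inf_\rho\big(\int|x-y|^\ell\rho(dx,dy)\big)^{1/(\ell\vee 1)}$, and let $W_0(\mu,\nu)=\inf_\rho\rho(x\ne y)$ and $\underline W(\mu,\nu)=\inf_\rho\int(|x-y|\wedge 1)\,\rho(dx,dy)$, the infima being over all couplings $\rho$ of $\mu$ and $\nu$; $|\mu-\nu|$ denotes the total variation measure of $\mu-\nu$. A function $U:\mathcal P_\ell(\mathbb R^d)\to\mathbb R$ admits the linear functional derivative $\frac{\delta U}{\delta m}(\mu,\cdot)$ at $\mu\in\mathcal P_\ell(\mathbb R^d)$ if $y\mapsto\frac{\delta U}{\delta m}(\mu,y)$ is a measurable real function with $\sup_y|\frac{\delta U}{\delta m}(\mu,y)|/(1+|y|^\ell)<\infty$ and $$\forall\nu\in\mathcal P_\ell(\mathbb R^d),\quad \frac{d}{d\varepsilon}\Big|_{\varepsilon=0^+}U(\mu+\varepsilon(\nu-\mu))=\int\frac{\delta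 U}{\delta m}(\mu,y)\,(\nu-\mu)(dy)$$ (such a function is determined up to an additive constant depending on $\mu$; below, any fixed choice of these constants, for instance $\frac{\delta U}{\delta m}(\mu,0)=0$, is allowed). **Theorem.** Let $\ell\ge 0$, $m_0\in\mathcal P_\ell(\mathbb R^d)$, let $(\zeta_i)_{i\ge1}$ be i.i.d. random variables with law $m_0$ and $m^N=\frac1N\sum_{i=1}^N\delta_{\zeta_i}$. Let $D(\mu,\nu)=\int(1+|y|^\ell)\,|\mu-\nu|(dy)$ if $m_0$ is discrete (carried by a countable set); otherwise let $D=W_\ell$ if $\ell>0$ and $D=\underline W$ if $\ell=0$. Let $U:\mathcal P_\ell(\mathbb R^d)\to\mathbb R$ be measurable, and suppose that there is $r>0$ such that, with $B(m_0,r)=\{\mu\in\mathcal P_\ell(\mathbb R^d): D(\mu,m_0)<r\}$: 1. $U$ admits a linear functional derivative $\frac{\delta U}{\delta m}(\mu,\cdot)$ at every $\mu\in B(m_0,r)$; 2. there is $C<\infty$ such that $\big|\frac{\delta U}{\delta m}(\mu,x)\big|\le C(1+|x|^{\ell/2})$ for all $(\mu,x)\in B(m_0,r)\times\mathbb R^d$;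 3. there are $\alpha\in(1/2,1]$ and $C<\infty$ such that for all $\mu_1,\mu_2\in B(m_0,r)$ and $x\in\mathbb R^d$, $$\Big|\frac{\delta U}{\delta m}(\mu_2,x)-\frac{\delta U}{\delta m}(\mu_1,x)\Big|\le C\Big((1+|x|^\ell)\,W_0(\mu_2,\mu_1)^\alpha+(1+|x|^{\ell(1-\alpha)})\Big(\int|y|^\ell\,|\mu_2-\mu_1|(dy)\Big)^\alpha\Big);$$ 4. $\displaystyle\sup_{x\in\mathbb R^d}\frac{\big|\frac{\delta U}{\delta m}(\mu,x)-\frac{\delta U}{\delta m}(m_0,x)\big|}{1+|x|^{\ell/2}}\to 0$ as $D(\mu,m_0)\to0$. Then $\frac{\delta U}{\delta m}(m_0,\zeta_1)$ is square integrable and, as $N\to\infty$, the following convergence in distribution holds: $$\sqrt N\big(U(m^N)-U(m_0)\big)\Longrightarrow\mathcal N\Big(0,\operatorname{Var}\Big(\frac{\delta U}{\delta m}(m_0,\zeta_1)\Big)\Big).$$ -/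

import Mathlib

open MeasureTheory ProbabilityTheory Filter Topology
open scoped ENNReal

namespace MeasureCLT

/-- The Euclidean space `ℝ^d`. -/
abbrev Euc (d : ℕ) : Type := EuclideanSpace ℝ (Fin d)

/-- `𝒫_ℓ(ℝ^d)`: the Borel probability measures `m` on `ℝ^d` with `∫ |x|^ℓ dm < ∞`. As a subtype of
`Measure (Euc d)` it carries the σ-algebra generated by the evaluations `m ↦ m A`, `A` Borel, which
is the Borel σ-algebra of the weak topology. -/
abbrev PMoment (d : ℕ) (l : ℝ) : Type :=
  {m : Measure (Euc d) // IsProbabilityMeasure m ∧ Integrable (fun x => ‖x‖ ^ l) m}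

instance PMoment.isProbabilityMeasure {d : ℕ} {l : ℝ} (m : PMoment d l) :
    IsProbabilityMeasure (m : Measure (Euc d)) :=
  m.2.1

/-- The mixture `μ + t (ν - μ) = (1 - t) μ + t ν`, for `t ∈ [0, 1]`. -/
noncomputable def mix {d : ℕ} {l : ℝ} (μ ν : PMoment d l) (t : unitInterval) : PMoment d l :=
  ⟨ENNReal.ofReal (1 - (t : ℝ)) • (μ : Measure (Euc d)) +
      ENNReal.ofReal (t : ℝ) • (ν : Measure (Euc d)), by
    refine ⟨⟨?_⟩, ?_⟩
    · have h0 : (0 : ℝ) ≤ 1 - (t : ℝ) := sub_nonneg.2 t.2.2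
      simp [← ENNReal.ofReal_add h0 t.2.1]
    · exact (μ.2.2.smul_measure ENNReal.ofReal_ne_top).add_measure
        (ν.2.2.smul_measure ENNReal.ofReal_ne_top)⟩

/-- The empirical measure `(1 / N) ∑_{i < N} δ_{z i}` of the first `N ≥ 1` terms of a sequence. -/
noncomputable def empirical {d : ℕ} (l : ℝ) (z : ℕ → Euc d) (N : ℕ) [NeZero N] : PMoment d l :=
  ⟨(N : ℝ≥0∞)⁻¹ • ∑ i ∈ Finset.range N, Measure.dirac (z i), by
    have hN : (N : ℝ≥0∞) ≠ 0 := Nat.cast_ne_zero.2 (NeZero.ne N)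
    refine ⟨⟨?_⟩, ?_⟩
    · simp [ENNReal.inv_mul_cancel hN (ENNReal.natCast_ne_top N)]
    · refine Integrable.smul_measure ?_ (ENNReal.inv_ne_top.2 hN)
      exact integrable_finsetSum_measure.2 fun i _ => integrable_dirac (by simp)⟩

/-- `ρ` is a coupling of `μ` and `ν`: its two marginals are `μ` and `ν`. -/
def IsCoupling {d : ℕ} (ρ : Measure (Euc d × Euc d)) (μ ν : Measure (Euc d)) : Prop :=
  ρ.fst = μ ∧ ρ.snd = ν

/-- `W_ℓ(μ, ν) = inf_ρ (∫ |x - y|^ℓ dρ)^{1 / (ℓ ∨ 1)}`, the `ℓ`-Wasserstein metric (used for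
`ℓ > 0`). -/
noncomputable def wasserstein {d : ℕ} (l : ℝ) (μ ν : Measure (Euc d)) : ℝ≥0∞ :=
  ⨅ (ρ : Measure (Euc d × Euc d)) (_ : IsCoupling ρ μ ν),
    (∫⁻ p, ENNReal.ofReal (‖p.1 - p.2‖ ^ l) ∂ρ) ^ (1 / max l 1)

/-- `W_0(μ, ν) = inf_ρ ρ(x ≠ y)`, the total variation metric. -/
noncomputable def wassersteinZero {d : ℕ} (μ ν : Measure (Euc d)) : ℝ≥0∞ :=
  ⨅ (ρ : Measure (Euc d × Euc d)) (_ : IsCoupling ρ μ ν), ρ {p | p.1 ≠ p.2}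

/-- `inf_ρ ∫ (|x - y| ∧ 1) dρ`, which metrizes weak convergence. -/
noncomputable def wassersteinTrunc {d : ℕ} (μ ν : Measure (Euc d)) : ℝ≥0∞ :=
  ⨅ (ρ : Measure (Euc d × Euc d)) (_ : IsCoupling ρ μ ν),
    ∫⁻ p, ENNReal.ofReal (min ‖p.1 - p.2‖ 1) ∂ρ

/-- `|μ - ν|`, the total variation measure of the signed measure `μ - ν`. -/
noncomputable def absDiff {d : ℕ} (μ ν : Measure (Euc d)) [IsFiniteMeasure μ] [IsFiniteMeasure ν] :
    Measure (Euc d) :=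
  (μ.toSignedMeasure - ν.toSignedMeasure).totalVariation

/-- `m` is discrete: it is carried by a countable set. -/
def IsDiscrete {d : ℕ} (m : Measure (Euc d)) : Prop :=
  ∃ S : Set (Euc d), S.Countable ∧ m Sᶜ = 0

open Classical in
/-- The metric `D` on `𝒫_ℓ(ℝ^d)` attached to `m₀`: `∫ (1 + |y|^ℓ) d|μ - ν|` if `m₀` is discrete,
otherwise `W_ℓ` if `ℓ > 0` and the weak convergence metric if `ℓ = 0`. -/
noncomputable def distD {d : ℕ} {l : ℝ} (m₀ μ ν : PMoment d l) : ℝ≥0∞ :=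
  if IsDiscrete (m₀ : Measure (Euc d)) then
    ∫⁻ y, ENNReal.ofReal (1 + ‖y‖ ^ l) ∂(absDiff (μ : Measure (Euc d)) (ν : Measure (Euc d)))
  else if 0 < l then wasserstein l (μ : Measure (Euc d)) (ν : Measure (Euc d))
  else wassersteinTrunc (μ : Measure (Euc d)) (ν : Measure (Euc d))

/-- The open ball `B(m₀, r)` for the metric `D`. -/
def ballD {d : ℕ} {l : ℝ} (m₀ : PMoment d l) (r : ℝ) : Set (PMoment d l) :=
  {μ | distD m₀ μ m₀ < ENNReal.ofReal r}

/-- `f` is (a version of) the linear functional derivative `δU/δm(μ, ·)` of `U` at `μ`: it is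
measurable, `|f(y)| ≤ C (1 + |y|^ℓ)`, and for every `ν ∈ 𝒫_ℓ(ℝ^d)` the right derivative at `ε = 0`
of `ε ↦ U(μ + ε (ν - μ))` is `∫ f d(ν - μ)`. (`Set.IccExtend` only turns the function of
`ε ∈ [0, 1]` into one of `ε ∈ ℝ`.) Two versions differ by an additive constant. -/
def IsLinearFunctionalDerivAt {d : ℕ} {l : ℝ} (U : PMoment d l → ℝ) (f : Euc d → ℝ)
    (μ : PMoment d l) : Prop :=
  Measurable f ∧ (∃ C : ℝ, ∀ y, |f y| ≤ C * (1 + ‖y‖ ^ l)) ∧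
    ∀ ν : PMoment d l,
      HasDerivWithinAt (Set.IccExtend (zero_le_one' ℝ) fun ε => U (mix μ ν ε))
        (∫ y, f y ∂(ν : Measure (Euc d)) - ∫ y, f y ∂(μ : Measure (Euc d))) (Set.Ici 0) 0

end MeasureCLT

namespace MeasureCLT

/-! ### Total variation measure of a difference -/

section AbsDiff

variable {d : ℕ} {μ ν κ₁ κ₂ : Measure (Euc d)} [IsFiniteMeasure μ] [IsFiniteMeasure ν]

/-! Replace the mass of `m₀` by the sample one atom at a time. The hybrid measure `hybrid m₀ z N i`
carries the first `i` atoms and keeps mass `(N - i) / N` on `m₀`, so `U(m^N) - U(m₀)` telescopes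
over `N` increments, each moving mass `1 / N` from `m₀` to one Dirac mass. By the mean value theorem
along the segment and the Hölder hypothesis, an increment equals `1 / N` times the derivative at the
hybrid measure, centered under `m₀` and evaluated at the new atom, up to an error of order `N ^ (-(1
+ α))` (`abs_sub_sub_centeredDeriv_le`). After summation and multiplication by `√N` the error is of
order `N ^ (1 / 2 - α)`, which vanishes because `α > 1 / 2` (`abs_sqrt_mul_sub_le`).

Splitting the derivative at the hybrid measure into its value at `m₀` plus a difference leaves two
sums. The first is a normalized i.i.d. sum, covered by the classical central limit theorem. In the
second, the `i`-th hybrid measure depends only on the earlier atoms, so the terms are martingale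
increments and are orthogonal in `L²` (`lintegral_enorm_sum_sq_le`). Their conditional variances are
small as soon as every hybrid measure is close to `m₀`, by the continuity hypothesis on the
derivative. Hence this sum vanishes in probability, and Slutsky's theorem concludes.

Closeness of the hybrids comes from the law of large numbers. The three choices of `D` are powers of
a functional `T` with the properties of `IsGauge`, one of which is that convergence of weighted
masses on countably many sets forces `T → 0`. Applied to empirical measures, this gives almost sure
convergence. As a hybrid lies on the segment from `m₀` to an earlier empirical measure, sublinearity
of `T` there makes the convergence uniform over hybrids (`IsGauge.eventually_forall_hybrid_lt`).

No joint measurability of the derivative in `(μ, x)` is assumed, and it is controlled only near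
`m₀`. The first point is handled by recovering the centered derivative as a limsup of difference
quotients of the measurable `U`. The second is handled by truncating the increments to zero outside
a measurable good set, which almost surely changes nothing for large `N`. -/

lemma absDiff_le_add [IsFiniteMeasure κ₁] [IsFiniteMeasure κ₂] (h : μ + κ₂ = ν + κ₁) :
    absDiff μ ν ≤ κ₁ + κ₂ := by
  have hs : ∀ A, MeasurableSet A →
      (μ.toSignedMeasure - ν.toSignedMeasure) A = κ₁.real A - κ₂.real A := by
    intro A hA
    have h1 : μ.real A + κ₂.real A = ν.real A + κ₁.real A := by
      rw [← measureReal_add_apply, ← measureReal_add_apply, h]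
    rw [Measure.toSignedMeasure_sub_apply hA]
    linarith
  -- On the Hahn set the positive part of `μ - ν = κ₁ - κ₂` is at most `κ₁`, and on its complement
  -- the negative part is at most `κ₂`: the Jordan decomposition is minimal.
  obtain ⟨i, hi, h0, h1, hp, hn⟩ :=
    (μ.toSignedMeasure - ν.toSignedMeasure).toJordanDecomposition_spec
  refine Measure.le_iff.2 fun A hA => ?_
  rw [absDiff, SignedMeasure.totalVariation, Measure.add_apply, Measure.add_apply, hp, hn]
  refine add_le_add ?_ ?_
  · rw [← ofReal_measureReal (measure_ne_top _ _),
      SignedMeasure.toMeasureOfZeroLE_real_apply _ h0 hi hA, hs _ (hi.inter hA)]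
    refine ENNReal.ofReal_le_of_le_toReal ?_
    have : κ₁.real (i ∩ A) ≤ κ₁.real A := measureReal_mono Set.inter_subset_right
    exact (sub_le_self _ measureReal_nonneg).trans this
  · rw [← ofReal_measureReal (measure_ne_top _ _),
      SignedMeasure.toMeasureOfLEZero_real_apply _ h1 hi.compl hA, hs _ (hi.compl.inter hA)]
    refine ENNReal.ofReal_le_of_le_toReal ?_
    have : κ₂.real (iᶜ ∩ A) ≤ κ₂.real A := measureReal_mono Set.inter_subset_right
    have h2 : 0 ≤ κ₁.real (iᶜ ∩ A) := measureReal_nonneg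
    change _ ≤ κ₂.real A
    linarith

lemma lintegral_absDiff_le [IsFiniteMeasure κ₁] [IsFiniteMeasure κ₂] (h : μ + κ₂ = ν + κ₁)
    (f : Euc d → ℝ≥0∞) :
    ∫⁻ y, f y ∂(absDiff μ ν) ≤ ∫⁻ y, f y ∂κ₁ + ∫⁻ y, f y ∂κ₂ := by
  rw [← lintegral_add_measure]
  exact lintegral_mono' (absDiff_le_add h) le_rfl

variable (μ ν) in
lemma exists_add_eq_absDiff : ∃ κ₁ κ₂ : Measure (Euc d), IsFiniteMeasure κ₁ ∧ IsFiniteMeasure κ₂ ∧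
    μ + κ₂ = ν + κ₁ ∧ absDiff μ ν = κ₁ + κ₂ := by
  set s := μ.toSignedMeasure - ν.toSignedMeasure with hs
  refine ⟨s.toJordanDecomposition.posPart, s.toJordanDecomposition.negPart, inferInstance,
    inferInstance, ?_, rfl⟩
  have h := s.toSignedMeasure_toJordanDecomposition
  refine Measure.ext fun A hA => ?_
  have hA' : s.toJordanDecomposition.toSignedMeasure A = s A := by rw [h]
  rw [JordanDecomposition.toSignedMeasure, Measure.toSignedMeasure_sub_apply hA, hs,
    Measure.toSignedMeasure_sub_apply hA, ← hs] at hA'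
  refine (ENNReal.toReal_eq_toReal_iff' (measure_ne_top _ _) (measure_ne_top _ _)).1 ?_
  change Measure.real _ A = Measure.real _ A
  rw [measureReal_add_apply, measureReal_add_apply]
  linarith

lemma absDiff_self : absDiff μ μ = 0 := by
  simp [absDiff, SignedMeasure.totalVariation_zero]

end AbsDiff

/-! ### Couplings built from a partition into cells -/

section Cells

variable {α : Type*} [MeasurableSpace α] (A : ℕ → Set α) (J : Finset ℕ) (μ ν : Measure α)

/-- The part of `μ` that is matched with `ν` inside the cells `A j`, `j ∈ J`. -/
noncomputable def matchedPart : Measure α :=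
  ∑ j ∈ J, (ν (A j) / max (μ (A j)) (ν (A j))) • μ.restrict (A j)

/-- The part of `μ` that is not matched with `ν` inside the cells `A j`, `j ∈ J`. -/
noncomputable def residualPart : Measure α :=
  μ.restrict (⋃ j ∈ J, A j)ᶜ +
    ∑ j ∈ J, (1 - ν (A j) / max (μ (A j)) (ν (A j))) • μ.restrict (A j)

variable {A J μ ν}

lemma matchedPart_add_residualPart (hA : ∀ j, MeasurableSet (A j))
    (hd : Pairwise (Function.onFun Disjoint A)) :
    matchedPart A J μ ν + residualPart A J μ ν = μ := by
  have h1 : ∀ j, (ν (A j) / max (μ (A j)) (ν (A j))) • μ.restrict (A j) +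
      (1 - ν (A j) / max (μ (A j)) (ν (A j))) • μ.restrict (A j) = μ.restrict (A j) := by
    intro j
    rw [← add_smul, add_tsub_cancel_of_le, one_smul]
    exact ENNReal.div_le_of_le_mul (by simp)
  have h2 : ∑ j ∈ J, μ.restrict (A j) = μ.restrict (⋃ j ∈ J, A j) := by
    refine Measure.ext fun s hs => ?_
    rw [Measure.restrict_apply hs, Set.inter_iUnion₂,
      measure_biUnion_finset (fun i _ j _ hij => (hd hij).mono Set.inter_subset_right
        Set.inter_subset_right) (fun j _ => hs.inter (hA j))]
    simp [Measure.restrict_apply hs]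
  rw [matchedPart, residualPart, add_comm (μ.restrict _), ← add_assoc, ← Finset.sum_add_distrib,
    Finset.sum_congr rfl fun j _ => h1 j, h2,
    Measure.restrict_add_restrict_compl (Finset.measurableSet_biUnion _ fun j _ => hA j)]

/-- The mass matched in cell `j` is the product of the two cell masses divided by their maximum,
that is, their minimum, which is symmetric. Equality of the residual masses, needed to couple the
residuals, follows. -/
lemma matchedPart_univ_comm : matchedPart A J μ ν Set.univ = matchedPart A J ν μ Set.univ := by
  simp only [matchedPart, Measure.finsetSum_apply, Measure.smul_apply, Measure.restrict_apply_univ,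
    smul_eq_mul, ENNReal.div_eq_inv_mul]
  refine Finset.sum_congr rfl fun j _ => ?_
  rw [max_comm]; ring

lemma residualPart_univ_comm [IsProbabilityMeasure μ] [IsProbabilityMeasure ν]
    (hA : ∀ j, MeasurableSet (A j)) (hd : Pairwise (Function.onFun Disjoint A)) :
    residualPart A J μ ν Set.univ = residualPart A J ν μ Set.univ := by
  have h1 : matchedPart A J μ ν Set.univ + residualPart A J μ ν Set.univ = 1 := by
    rw [← Measure.add_apply, matchedPart_add_residualPart hA hd, measure_univ]
  have h2 : matchedPart A J μ ν Set.univ + residualPart A J ν μ Set.univ = 1 := by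
    rw [matchedPart_univ_comm, ← Measure.add_apply, matchedPart_add_residualPart hA hd,
      measure_univ]
  refine (ENNReal.add_right_inj ?_).1 (h1.trans h2.symm)
  exact ne_top_of_le_ne_top ENNReal.one_ne_top (h1 ▸ le_self_add)

lemma residualPart_le (hA : ∀ j, MeasurableSet (A j))
    (hd : Pairwise (Function.onFun Disjoint A)) : residualPart A J μ ν ≤ μ := by
  conv_rhs => rw [← matchedPart_add_residualPart (J := J) (ν := ν) (μ := μ) hA hd]
  exact Measure.le_add_left le_rfl

/-- On a one-point cell both matched parts are the same multiple of a Dirac mass. Only for such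
cells does matching masses make the measures themselves agree, which total variation needs. -/
lemma matchedPart_comm_of_subsingleton (hs : ∀ j, (A j).Subsingleton) :
    matchedPart A J μ ν = matchedPart A J ν μ := by
  refine Finset.sum_congr rfl fun j _ => ?_
  rcases (hs j).eq_empty_or_singleton with h | ⟨x, h⟩
  · simp [h]
  · rw [h, Measure.restrict_singleton, Measure.restrict_singleton, smul_smul, smul_smul, max_comm]
    congr 1
    simp only [ENNReal.div_eq_inv_mul]
    ring

lemma lintegral_residualPart (f : α → ℝ≥0∞) :
    ∫⁻ x, f x ∂(residualPart A J μ ν) = ∫⁻ x in (⋃ j ∈ J, A j)ᶜ, f x ∂μ +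
      ∑ j ∈ J, (1 - ν (A j) / max (μ (A j)) (ν (A j))) * ∫⁻ x in A j, f x ∂μ := by
  simp [residualPart, lintegral_add_measure, lintegral_finsetSum_measure]

/-- The coupling that matches `μ` and `ν` inside the cells as much as possible, and couples the
residual parts independently. -/
noncomputable def cellCoupling (A : ℕ → Set α) (J : Finset ℕ) (μ ν : Measure α) :
    Measure (α × α) :=
  ∑ j ∈ J, (max (μ (A j)) (ν (A j)))⁻¹ • (μ.restrict (A j)).prod (ν.restrict (A j)) +
    (residualPart A J μ ν Set.univ)⁻¹ • (residualPart A J μ ν).prod (residualPart A J ν μ)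

lemma finsetSum_fst {ι β : Type*} [MeasurableSpace β] (s : Finset ι) (ρ : ι → Measure (α × β)) :
    (∑ i ∈ s, ρ i).fst = ∑ i ∈ s, (ρ i).fst := by
  refine Measure.ext fun t ht => ?_
  simp [Measure.fst_apply ht, Measure.finsetSum_apply]

lemma finsetSum_snd {ι β : Type*} [MeasurableSpace β] (s : Finset ι) (ρ : ι → Measure (α × β)) :
    (∑ i ∈ s, ρ i).snd = ∑ i ∈ s, (ρ i).snd := by
  refine Measure.ext fun t ht => ?_
  simp [Measure.snd_apply ht, Measure.finsetSum_apply]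

lemma inv_smul_prod_fst {ρ σ : Measure α} [IsFiniteMeasure ρ] [SFinite σ]
    (h : ρ Set.univ = σ Set.univ) : ((ρ Set.univ)⁻¹ • ρ.prod σ).fst = ρ := by
  -- With zero mass the normalizing factor is `∞`, but it multiplies the zero measure.
  rcases eq_or_ne (ρ Set.univ) 0 with h0 | h0
  · rw [Measure.measure_univ_eq_zero] at h0
    simp [h0]
  · rw [Measure.fst, Measure.map_smul, Measure.map_fst_prod, ← h, smul_smul,
      ENNReal.inv_mul_cancel h0 (measure_ne_top _ _), one_smul]

lemma inv_smul_prod_snd {ρ σ : Measure α} [IsFiniteMeasure ρ] [SFinite σ]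
    (h : ρ Set.univ = σ Set.univ) : ((ρ Set.univ)⁻¹ • ρ.prod σ).snd = σ := by
  rcases eq_or_ne (ρ Set.univ) 0 with h0 | h0
  · have h1 := h0
    rw [h, Measure.measure_univ_eq_zero] at h1
    simp [h1]
  · rw [Measure.snd, Measure.map_smul, Measure.map_snd_prod, smul_smul,
      ENNReal.inv_mul_cancel h0 (measure_ne_top _ _), one_smul]

lemma cellCoupling_fst [IsProbabilityMeasure μ] [IsProbabilityMeasure ν]
    (hA : ∀ j, MeasurableSet (A j)) (hd : Pairwise (Function.onFun Disjoint A)) :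
    (cellCoupling A J μ ν).fst = μ := by
  have := isFiniteMeasure_of_le _ (residualPart_le (J := J) (μ := μ) (ν := ν) hA hd)
  have := isFiniteMeasure_of_le _ (residualPart_le (J := J) (μ := ν) (ν := μ) hA hd)
  rw [cellCoupling, Measure.fst_add, finsetSum_fst,
    inv_smul_prod_fst (residualPart_univ_comm hA hd)]
  conv_rhs => rw [← matchedPart_add_residualPart (J := J) (ν := ν) (μ := μ) hA hd]
  congr 1
  refine Finset.sum_congr rfl fun j _ => ?_
  rw [Measure.fst, Measure.map_smul, Measure.map_fst_prod, smul_smul, Measure.restrict_apply_univ,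
    ENNReal.div_eq_inv_mul]

lemma cellCoupling_snd [IsProbabilityMeasure μ] [IsProbabilityMeasure ν]
    (hA : ∀ j, MeasurableSet (A j)) (hd : Pairwise (Function.onFun Disjoint A)) :
    (cellCoupling A J μ ν).snd = ν := by
  have := isFiniteMeasure_of_le _ (residualPart_le (J := J) (μ := μ) (ν := ν) hA hd)
  have := isFiniteMeasure_of_le _ (residualPart_le (J := J) (μ := ν) (ν := μ) hA hd)
  rw [cellCoupling, Measure.snd_add, finsetSum_snd,
    inv_smul_prod_snd (residualPart_univ_comm hA hd)]
  conv_rhs => rw [← matchedPart_add_residualPart (J := J) (ν := μ) (μ := ν) hA hd]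
  congr 1
  refine Finset.sum_congr rfl fun j _ => ?_
  rw [Measure.snd, Measure.map_smul, Measure.map_snd_prod, smul_smul, Measure.restrict_apply_univ,
    ENNReal.div_eq_inv_mul, max_comm]

lemma inv_mul_lintegral_prod_le {ρ σ : Measure α} [IsFiniteMeasure ρ] [IsFiniteMeasure σ]
    (h : ρ Set.univ = σ Set.univ) {w : α → ℝ≥0∞} (hw : Measurable w) :
    (ρ Set.univ)⁻¹ * ∫⁻ p, w p.1 + w p.2 ∂(ρ.prod σ) ≤ ∫⁻ x, w x ∂ρ + ∫⁻ x, w x ∂σ := by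
  rcases eq_or_ne (ρ Set.univ) 0 with h0 | h0
  · rw [Measure.measure_univ_eq_zero] at h0
    simp [h0]
  · have h1 : ∫⁻ p, w p.1 ∂((ρ Set.univ)⁻¹ • ρ.prod σ) = ∫⁻ x, w x ∂ρ := by
      conv_rhs => rw [← inv_smul_prod_fst h, Measure.fst, lintegral_map hw measurable_fst]
    have h2 : ∫⁻ p, w p.2 ∂((ρ Set.univ)⁻¹ • ρ.prod σ) = ∫⁻ x, w x ∂σ := by
      conv_rhs => rw [← inv_smul_prod_snd h, Measure.snd, lintegral_map hw measurable_snd]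
    rw [← smul_eq_mul, ← lintegral_smul_measure, lintegral_add_left (by fun_prop), h1, h2]

/-- Mass matched inside a cell, at most one in total, travels at cost at most `ε`. The rest is paid
for by the weight of the two residual parts, since the normalized product of the residuals has them
as marginals. -/
lemma lintegral_cellCoupling_le [IsProbabilityMeasure μ] [IsProbabilityMeasure ν]
    (hA : ∀ j, MeasurableSet (A j)) (hd : Pairwise (Function.onFun Disjoint A))
    {c : α × α → ℝ≥0∞} {w : α → ℝ≥0∞} (hw : Measurable w) {ε K : ℝ≥0∞}
    (hK : K ≠ ∞) (hc : ∀ p, c p ≤ K * (w p.1 + w p.2))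
    (hε : ∀ j, ∀ x ∈ A j, ∀ y ∈ A j, c (x, y) ≤ ε) :
    ∫⁻ p, c p ∂(cellCoupling A J μ ν) ≤ ε + K * (∫⁻ x, w x ∂(residualPart A J μ ν) +
      ∫⁻ x, w x ∂(residualPart A J ν μ)) := by
  have := isFiniteMeasure_of_le _ (residualPart_le (J := J) (μ := μ) (ν := ν) hA hd)
  have := isFiniteMeasure_of_le _ (residualPart_le (J := J) (μ := ν) (ν := μ) hA hd)
  rw [cellCoupling, lintegral_add_measure, lintegral_finsetSum_measure]
  refine add_le_add ?_ ?_
  · have h1 : ∀ j, ∫⁻ p, c p ∂((max (μ (A j)) (ν (A j)))⁻¹ •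
        (μ.restrict (A j)).prod (ν.restrict (A j))) ≤
        ε * ((max (μ (A j)) (ν (A j)))⁻¹ * (μ (A j) * ν (A j))) := by
      intro j
      rw [lintegral_smul_measure, smul_eq_mul, Measure.prod_restrict, mul_left_comm]
      refine mul_le_mul_right ?_ _
      refine (setLIntegral_mono' ((hA j).prod (hA j)) (g := fun _ => ε)
        fun p hp => hε j p.1 hp.1 p.2 hp.2).trans ?_
      simp
    refine (Finset.sum_le_sum fun j _ => h1 j).trans ?_
    rw [← Finset.mul_sum]
    refine mul_le_of_le_one_right' ?_
    have h2 : ∑ j ∈ J, (max (μ (A j)) (ν (A j)))⁻¹ * (μ (A j) * ν (A j)) =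
        matchedPart A J μ ν Set.univ := by
      simp only [matchedPart, Measure.finsetSum_apply, Measure.smul_apply,
        Measure.restrict_apply_univ, smul_eq_mul, ENNReal.div_eq_inv_mul]
      exact Finset.sum_congr rfl fun j _ => by ring
    rw [h2]
    refine le_trans ?_ (measure_univ (μ := μ)).le
    conv_rhs => rw [← matchedPart_add_residualPart (J := J) (ν := ν) (μ := μ) hA hd]
    exact le_self_add
  · rw [lintegral_smul_measure, smul_eq_mul]
    refine (mul_le_mul_right (lintegral_mono hc) _).trans ?_
    rw [lintegral_const_mul' _ _ hK, mul_left_comm]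
    exact mul_le_mul_right (inv_mul_lintegral_prod_le (residualPart_univ_comm hA hd) hw) _

end Cells
end MeasureCLT

namespace MeasureCLT

/-! ### Residual mass along convergent cell masses -/

section Residual

/-- If `b ≠ 0` the ratio tends to one. If `b = 0` the ratio is uncontrolled, but the factor `f`
tends to zero. -/
lemma tendsto_one_sub_div_max_mul {a b' f : ℕ → ℝ≥0∞} {b F : ℝ≥0∞} (ha : Tendsto a atTop (𝓝 b))
    (hb' : Tendsto b' atTop (𝓝 b))
    (hb : b ≠ ∞) (hf : Tendsto f atTop (𝓝 F)) (hF : F ≠ ∞) (h0 : b = 0 → F = 0) :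
    Tendsto (fun n => (1 - b' n / max (a n) (b' n)) * f n) atTop (𝓝 0) := by
  rcases eq_or_ne b 0 with hb0 | hb0
  · refine tendsto_of_tendsto_of_tendsto_of_le_of_le tendsto_const_nhds (h0 hb0 ▸ hf)
      (fun _ => zero_le) fun n => ?_
    exact mul_le_of_le_one_left' tsub_le_self
  · have h1 : Tendsto (fun n => b' n / max (a n) (b' n)) atTop (𝓝 (b / max b b)) :=
      ENNReal.Tendsto.div hb' (Or.inl hb0) (ha.max hb') (Or.inl (by simpa using hb))
    rw [max_self, ENNReal.div_self hb0 hb] at h1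
    have h2 := ENNReal.Tendsto.mul
      (ENNReal.Tendsto.sub (tendsto_const_nhds (x := (1 : ℝ≥0∞))) h1 (Or.inl ENNReal.one_ne_top))
      (Or.inr hF) hf (Or.inr (by simp))
    simpa using h2

variable {α : Type*} [MeasurableSpace α] {A : ℕ → Set α} {ν : Measure α} {w : α → ℝ≥0∞}

lemma tendsto_setLIntegral_compl_biUnion_range (hA : ∀ j, MeasurableSet (A j))
    (hc : ν (⋃ j, A j)ᶜ = 0) (hwν : ∫⁻ x, w x ∂ν ≠ ∞) :
    Tendsto (fun m => ∫⁻ x in (⋃ j ∈ Finset.range m, A j)ᶜ, w x ∂ν) atTop (𝓝 0) := by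
  have hm : ∀ m, MeasurableSet (⋃ j ∈ Finset.range m, A j)ᶜ := fun m =>
    (Finset.measurableSet_biUnion _ fun j _ => hA j).compl
  have h1 : ∀ s, MeasurableSet s → ∫⁻ x in s, w x ∂ν = ν.withDensity w s :=
    fun s hs => (withDensity_apply w hs).symm
  simp_rw [h1 _ (hm _)]
  have : IsFiniteMeasure (ν.withDensity w) := isFiniteMeasure_withDensity hwν
  have h2 := tendsto_measure_iInter_atTop (μ := ν.withDensity w)
    (fun m => (hm m).nullMeasurableSet) (fun m n hmn => Set.compl_subset_compl.2
      (Set.biUnion_subset_biUnion_left fun j hj => Finset.mem_range.2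
        ((Finset.mem_range.1 hj).trans_le hmn))) ⟨0, measure_ne_top _ _⟩
  have h3 : ⋂ m, (⋃ j ∈ Finset.range m, A j)ᶜ = (⋃ j, A j)ᶜ := by
    ext x
    simp only [Set.mem_iInter, Set.mem_compl_iff, Set.mem_iUnion, not_exists, Finset.mem_range]
    exact ⟨fun h j hj => h (j + 1) j (Nat.lt_succ_self j) hj, fun h _ j _ => h j⟩
  rwa [h3, withDensity_absolutelyContinuous ν w hc] at h2

/-- First fix finitely many cells outside which `ν` has small weight. The contributions of those
cells to the residuals then vanish in the limit, leaving twice the weight of `ν` outside them. -/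
lemma exists_eventually_residualPart_lt {μ : ℕ → Measure α} [IsFiniteMeasure ν]
    (hA : ∀ j, MeasurableSet (A j))
    (hc : ν (⋃ j, A j)ᶜ = 0) (hwν : ∫⁻ x, w x ∂ν ≠ ∞)
    (h1 : ∀ j, Tendsto (fun n => μ n (A j)) atTop (𝓝 (ν (A j))))
    (h2 : ∀ j, Tendsto (fun n => ∫⁻ x in A j, w x ∂(μ n)) atTop (𝓝 (∫⁻ x in A j, w x ∂ν)))
    (h3 : ∀ m, Tendsto (fun n => ∫⁻ x in (⋃ j ∈ Finset.range m, A j)ᶜ, w x ∂(μ n)) atTop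
      (𝓝 (∫⁻ x in (⋃ j ∈ Finset.range m, A j)ᶜ, w x ∂ν))) {η : ℝ≥0∞} (hη : 0 < η) :
    ∃ m, ∀ᶠ n in atTop, ∫⁻ x, w x ∂(residualPart A (Finset.range m) (μ n) ν) +
      ∫⁻ x, w x ∂(residualPart A (Finset.range m) ν (μ n)) < η := by
  have hlim := tendsto_setLIntegral_compl_biUnion_range hA hc hwν
  have hlim2 := hlim.add hlim
  rw [add_zero] at hlim2
  obtain ⟨m, hm⟩ := (hlim2.eventually (gt_mem_nhds hη)).exists
  refine ⟨m, ?_⟩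
  have hfin : ∀ s, ∫⁻ x in s, w x ∂ν ≠ ∞ := fun s =>
    ne_top_of_le_ne_top hwν (setLIntegral_le_lintegral _ _)
  have hz : ∀ j, ν (A j) = 0 → ∫⁻ x in A j, w x ∂ν = 0 := fun j hj =>
    setLIntegral_measure_zero _ _ hj
  have hr1 : Tendsto (fun n => ∫⁻ x, w x ∂(residualPart A (Finset.range m) (μ n) ν)) atTop
      (𝓝 (∫⁻ x in (⋃ j ∈ Finset.range m, A j)ᶜ, w x ∂ν + ∑ j ∈ Finset.range m, 0)) := by
    simp_rw [lintegral_residualPart]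
    exact (h3 m).add (tendsto_finsetSum _ fun j _ => tendsto_one_sub_div_max_mul (h1 j)
      tendsto_const_nhds (measure_ne_top _ _) (h2 j) (hfin _) (hz j))
  have hr2 : Tendsto (fun n => ∫⁻ x, w x ∂(residualPart A (Finset.range m) ν (μ n))) atTop
      (𝓝 (∫⁻ x in (⋃ j ∈ Finset.range m, A j)ᶜ, w x ∂ν + ∑ j ∈ Finset.range m, 0)) := by
    simp_rw [lintegral_residualPart]
    exact tendsto_const_nhds.add (tendsto_finsetSum _ fun j _ => tendsto_one_sub_div_max_mul
      tendsto_const_nhds (h1 j) (measure_ne_top _ _) tendsto_const_nhds (hfin _) (hz j))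
  have hr := hr1.add hr2
  simp only [Finset.sum_const_zero, add_zero] at hr
  exact hr.eventually (gt_mem_nhds hm)

end Residual

/-! ### Gauges: transport costs and weighted total variation -/

/-- The optimal transport cost between `μ` and `ν` for the cost function `c`. -/
noncomputable def transportCost {d : ℕ} (c : Euc d × Euc d → ℝ≥0∞) (μ ν : Measure (Euc d)) : ℝ≥0∞ :=
  ⨅ (ρ : Measure (Euc d × Euc d)) (_ : IsCoupling ρ μ ν), ∫⁻ p, c p ∂ρ

lemma transportCost_le {d : ℕ} {c : Euc d × Euc d → ℝ≥0∞} {μ ν : Measure (Euc d)}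
    {ρ : Measure (Euc d × Euc d)} (h : IsCoupling ρ μ ν) :
    transportCost c μ ν ≤ ∫⁻ p, c p ∂ρ :=
  iInf₂_le (f := fun ρ (_ : IsCoupling ρ μ ν) => ∫⁻ p, c p ∂ρ) ρ h

lemma exists_coupling_lt {d : ℕ} {c : Euc d × Euc d → ℝ≥0∞} {μ ν : Measure (Euc d)} {b : ℝ≥0∞}
    (h : transportCost c μ ν < b) : ∃ ρ, IsCoupling ρ μ ν ∧ ∫⁻ p, c p ∂ρ < b := by
  simpa [transportCost, iInf_lt_iff] using h

/-- The weight `1 + |x|^ℓ`. -/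
noncomputable def weight {d : ℕ} (l : ℝ) (x : Euc d) : ℝ≥0∞ := ENNReal.ofReal (1 + ‖x‖ ^ l)

lemma measurable_weight {d : ℕ} {l : ℝ} : Measurable (weight l : Euc d → ℝ≥0∞) := by
  unfold weight; fun_prop

lemma one_le_weight {d : ℕ} {l : ℝ} (x : Euc d) : 1 ≤ weight l x := by
  rw [weight, ← ENNReal.ofReal_one]
  exact ENNReal.ofReal_le_ofReal (le_add_of_nonneg_right (by positivity))

variable {d : ℕ} {l : ℝ}

lemma lintegral_weight_ne_top (μ : PMoment d l) : ∫⁻ x, weight l x ∂(μ : Measure (Euc d)) ≠ ∞ := by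
  have h : Integrable (fun x => 1 + ‖x‖ ^ l) (μ : Measure (Euc d)) :=
    (integrable_const _).add μ.2.2
  have := h.lintegral_lt_top
  exact this.ne

lemma mix_coe (μ ν : PMoment d l) (t : unitInterval) :
    (mix μ ν t : Measure (Euc d)) = ENNReal.ofReal (1 - (t : ℝ)) • (μ : Measure (Euc d)) +
      ENNReal.ofReal (t : ℝ) • (ν : Measure (Euc d)) := rfl

lemma ofReal_one_sub_add_ofReal (t : unitInterval) :
    ENNReal.ofReal (1 - (t : ℝ)) + ENNReal.ofReal (t : ℝ) = 1 := by
  rw [← ENNReal.ofReal_add (sub_nonneg.2 t.2.2) t.2.1]; simp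

lemma convexComb_le_max (t : unitInterval) (a b : ℝ≥0∞) :
    ENNReal.ofReal (1 - (t : ℝ)) * a + ENNReal.ofReal (t : ℝ) * b ≤ max a b := by
  calc _ ≤ ENNReal.ofReal (1 - (t : ℝ)) * max a b + ENNReal.ofReal (t : ℝ) * max a b := by
        gcongr <;> simp
    _ = max a b := by rw [← add_mul, ofReal_one_sub_add_ofReal, one_mul]

lemma IsCoupling.mix {ρ₁ ρ₂ : Measure (Euc d × Euc d)} {μ₁ μ₂ ν₁ ν₂ : Measure (Euc d)}
    (h₁ : IsCoupling ρ₁ μ₁ ν₁) (h₂ : IsCoupling ρ₂ μ₂ ν₂) (a b : ℝ≥0∞) :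
    IsCoupling (a • ρ₁ + b • ρ₂) (a • μ₁ + b • μ₂) (a • ν₁ + b • ν₂) := by
  obtain ⟨rfl, rfl⟩ := h₁
  obtain ⟨rfl, rfl⟩ := h₂
  constructor
  · rw [Measure.fst_add, Measure.fst, Measure.fst, Measure.map_smul, Measure.map_smul]; rfl
  · rw [Measure.snd_add, Measure.snd, Measure.snd, Measure.map_smul, Measure.map_smul]; rfl

/-- The diagonal coupling of a measure with itself. -/
noncomputable def diagCoupling (μ : Measure (Euc d)) : Measure (Euc d × Euc d) :=
  μ.map fun x => (x, x)

lemma isCoupling_diagCoupling (μ : Measure (Euc d)) : IsCoupling (diagCoupling μ) μ μ := by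
  constructor
  · rw [diagCoupling, Measure.fst, Measure.map_map measurable_fst (by fun_prop)]
    exact Measure.map_id
  · rw [diagCoupling, Measure.snd, Measure.map_map measurable_snd (by fun_prop)]
    exact Measure.map_id

lemma isCoupling_prod (μ ν : Measure (Euc d)) [IsProbabilityMeasure μ] [IsProbabilityMeasure ν] :
    IsCoupling (μ.prod ν) μ ν :=
  ⟨Measure.fst_prod, Measure.snd_prod⟩

lemma ofReal_mix_self (μ : Measure (Euc d)) (t : unitInterval) :
    ENNReal.ofReal (1 - (t : ℝ)) • μ + ENNReal.ofReal (t : ℝ) • μ = μ := by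
  rw [← add_smul, ofReal_one_sub_add_ofReal, one_smul]

/-- A gauge of a neighbourhood of `m₀`: a functional that vanishes at `m₀`, has convex sublevel
sets, is sublinear on segments from `m₀`, and tends to `0` along sequences for which the weighted
masses of countably many sets converge. -/
structure IsGauge (m₀ : PMoment d l) (T : PMoment d l → ℝ≥0∞) : Prop where
  self : T m₀ = 0
  lt_top : ∀ μ, T μ < ∞
  mix_le_max : ∀ μ ν t, T (mix μ ν t) ≤ max (T μ) (T ν)
  mix_le : ∀ μ (t : unitInterval), T (mix m₀ μ t) ≤ ENNReal.ofReal t * T μ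
  tendsto : ∃ 𝒜 : Set (Set (Euc d)), 𝒜.Countable ∧ (∀ A ∈ 𝒜, MeasurableSet A) ∧
    ∀ μ : ℕ → PMoment d l,
      (∀ A ∈ 𝒜, Tendsto (fun n => (μ n : Measure (Euc d)) A) atTop
        (𝓝 ((m₀ : Measure (Euc d)) A))) →
      (∀ A ∈ 𝒜, Tendsto (fun n => ∫⁻ x in A, weight l x ∂(μ n : Measure (Euc d))) atTop
        (𝓝 (∫⁻ x in A, weight l x ∂(m₀ : Measure (Euc d))))) →
      Tendsto (fun n => T (μ n)) atTop (𝓝 0)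

lemma exists_disjoint_cells {δ : ℝ} (hδ : 0 < δ) : ∃ A : ℕ → Set (Euc d),
    (∀ j, MeasurableSet (A j)) ∧ Pairwise (Function.onFun Disjoint A) ∧ (⋃ j, A j) = Set.univ ∧
      ∀ j, ∀ x ∈ A j, ∀ y ∈ A j, dist x y < δ := by
  refine ⟨disjointed fun j => Metric.ball (TopologicalSpace.denseSeq (Euc d) j) (δ / 2),
    fun j => MeasurableSet.disjointed (fun i => Metric.isOpen_ball.measurableSet) j,
    disjoint_disjointed _, ?_, ?_⟩
  · rw [iUnion_disjointed, Set.eq_univ_iff_forall]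
    intro x
    obtain ⟨j, hj⟩ := (TopologicalSpace.denseRange_denseSeq (Euc d)).exists_dist_lt x
      (half_pos hδ)
    exact Set.mem_iUnion.2 ⟨j, hj⟩
  · intro j x hx y hy
    have h1 := disjointed_subset _ j hx
    have h2 := disjointed_subset _ j hy
    rw [Metric.mem_ball] at h1 h2
    linarith [dist_triangle_right x y (TopologicalSpace.denseSeq (Euc d) j)]

/-- The sets used to test convergence for the cells `A`. -/
def testSets (A : ℕ → Set (Euc d)) : Set (Set (Euc d)) :=
  Set.range A ∪ Set.range fun m => (⋃ j ∈ Finset.range m, A j)ᶜ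

lemma countable_testSets (A : ℕ → Set (Euc d)) : (testSets A).Countable :=
  (Set.countable_range _).union (Set.countable_range _)

lemma measurableSet_of_mem_testSets {A : ℕ → Set (Euc d)} (hA : ∀ j, MeasurableSet (A j))
    {s : Set (Euc d)} (hs : s ∈ testSets A) : MeasurableSet s := by
  rcases hs with ⟨j, rfl⟩ | ⟨m, rfl⟩
  · exact hA j
  · exact (Finset.measurableSet_biUnion _ fun j _ => hA j).compl

/-- The cost is linear in the coupling, so mixing couplings gives both segment properties, the
diagonal coupling of `m₀` costing nothing. For the convergence property, `hcs` makes transport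
within small cells cheap, and `hcK` bounds the cost of the residual mass by its weight. -/
lemma isGauge_transportCost (m₀ : PMoment d l) {c : Euc d × Euc d → ℝ≥0∞} (hcm : Measurable c)
    (hc0 : ∀ x, c (x, x) = 0) {K : ℝ≥0∞} (hK : K ≠ ∞)
    (hcK : ∀ p, c p ≤ K * (weight l p.1 + weight l p.2))
    (hcs : ∀ η : ℝ≥0∞, 0 < η → ∃ δ > 0, ∀ x y, dist x y < δ → c (x, y) ≤ η) :
    IsGauge m₀ fun μ => transportCost c (μ : Measure (Euc d)) (m₀ : Measure (Euc d)) := by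
  have hdiag : ∫⁻ p, c p ∂(diagCoupling (m₀ : Measure (Euc d))) = 0 := by
    rw [diagCoupling, lintegral_map hcm (by fun_prop)]
    simp [hc0]
  refine ⟨?_, ?_, ?_, ?_, ?_⟩
  · exact le_antisymm ((transportCost_le (isCoupling_diagCoupling _)).trans hdiag.le) zero_le
  · intro μ
    refine (transportCost_le (isCoupling_prod (μ : Measure (Euc d)) (m₀ : Measure (Euc d)))).trans_lt ?_
    have h := inv_mul_lintegral_prod_le (ρ := (μ : Measure (Euc d)))
      (σ := (m₀ : Measure (Euc d))) (by simp) (measurable_weight (l := l))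
    simp only [measure_univ, inv_one, one_mul] at h
    refine (lintegral_mono hcK).trans_lt ?_
    rw [lintegral_const_mul' _ _ hK]
    refine ENNReal.mul_lt_top hK.lt_top (h.trans_lt ?_)
    exact ENNReal.add_lt_top.2 ⟨(lintegral_weight_ne_top μ).lt_top,
      (lintegral_weight_ne_top m₀).lt_top⟩
  · intro μ ν t
    refine le_of_forall_gt fun b hb => ?_
    obtain ⟨h1, h2⟩ := max_lt_iff.1 hb
    obtain ⟨ρ₁, hρ₁, h1⟩ := exists_coupling_lt h1
    obtain ⟨ρ₂, hρ₂, h2⟩ := exists_coupling_lt h2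
    refine lt_of_le_of_lt ?_ (max_lt h1 h2)
    have h := hρ₁.mix hρ₂ (ENNReal.ofReal (1 - (t : ℝ))) (ENNReal.ofReal (t : ℝ))
    rw [ofReal_mix_self, ← mix_coe] at h
    refine (transportCost_le h).trans ?_
    rw [lintegral_add_measure, lintegral_smul_measure, lintegral_smul_measure]
    exact convexComb_le_max _ _ _
  · intro μ t
    -- A factor passes through the infimum only when it is nonzero, so the trivial mixture is
    -- treated apart.
    rcases eq_or_ne (ENNReal.ofReal (t : ℝ)) 0 with ht | ht
    · have h1 := ofReal_one_sub_add_ofReal t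
      rw [ht, add_zero] at h1
      have h2 : (mix m₀ μ t : Measure (Euc d)) = (m₀ : Measure (Euc d)) := by
        rw [mix_coe, ht, h1, one_smul, zero_smul, add_zero]
      rw [ht, zero_mul]
      change transportCost c (mix m₀ μ t : Measure (Euc d)) _ ≤ 0
      rw [h2]
      exact (transportCost_le (isCoupling_diagCoupling _)).trans hdiag.le
    conv_rhs => rw [transportCost]
    rw [ENNReal.mul_iInf_of_ne ht ENNReal.ofReal_ne_top]
    refine le_iInf fun ρ => ?_
    rw [ENNReal.mul_iInf_of_ne ht ENNReal.ofReal_ne_top]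
    refine le_iInf fun hρ => ?_
    have h := (isCoupling_diagCoupling (m₀ : Measure (Euc d))).mix hρ
      (ENNReal.ofReal (1 - (t : ℝ))) (ENNReal.ofReal (t : ℝ))
    rw [ofReal_mix_self, ← mix_coe] at h
    refine (transportCost_le h).trans ?_
    rw [lintegral_add_measure, lintegral_smul_measure, lintegral_smul_measure, hdiag]
    simp
  -- The test family must be fixed before the accuracy `η` is known, so it gathers partitions at
  -- every scale `1 / (k + 1)`. It stays countable.
  · choose A hAm hAd hAu hAs using fun k : ℕ => exists_disjoint_cells (d := d)
      (Nat.one_div_pos_of_nat (α := ℝ) (n := k))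
    refine ⟨⋃ k, testSets (A k), Set.countable_iUnion fun k => countable_testSets _, ?_, ?_⟩
    · intro s hs
      obtain ⟨k, hk⟩ := Set.mem_iUnion.1 hs
      exact measurableSet_of_mem_testSets (hAm k) hk
    · intro μ h1 h2
      refine ENNReal.tendsto_nhds_zero.2 fun η hη => ?_
      -- One half of `η` pays for transport inside the cells, the other for the residual mass.
      have hη2 : 0 < η / 2 := ENNReal.half_pos hη.ne'
      obtain ⟨δ, hδ, hδc⟩ := hcs _ hη2
      obtain ⟨k, hk⟩ := exists_nat_one_div_lt hδ
      have hm1 : ∀ j, A k j ∈ ⋃ k, testSets (A k) := fun j =>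
        Set.mem_iUnion.2 ⟨k, Or.inl ⟨j, rfl⟩⟩
      have hm2 : ∀ m, (⋃ j ∈ Finset.range m, A k j)ᶜ ∈ ⋃ k, testSets (A k) := fun m =>
        Set.mem_iUnion.2 ⟨k, Or.inr ⟨m, rfl⟩⟩
      obtain ⟨m, hm⟩ := exists_eventually_residualPart_lt (hAm k)
        (by rw [hAu]; simp) (lintegral_weight_ne_top m₀) (fun j => h1 _ (hm1 j))
        (fun j => h2 _ (hm1 j)) (fun m => h2 _ (hm2 m)) (ENNReal.div_pos hη2.ne' hK)
      filter_upwards [hm] with n hn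
      refine (transportCost_le ⟨cellCoupling_fst (J := Finset.range m) (hAm k) (hAd k),
        cellCoupling_snd (hAm k) (hAd k)⟩).trans ?_
      refine (lintegral_cellCoupling_le (hAm k) (hAd k) measurable_weight hK hcK
        (fun j x hx y hy => hδc x y ((hAs k j x hx y hy).trans hk))).trans ?_
      conv_rhs => rw [← ENNReal.add_halves η]
      exact add_le_add le_rfl ((mul_le_mul_right hn.le _).trans ENNReal.mul_div_le)

/-- Discreteness allows a countable family of one-point cells carrying `m₀`. The matched parts then
coincide, and `|μ - m₀|` is dominated by the two residuals. The segment properties come from scaling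
Jordan decompositions and minimality. -/
lemma isGauge_absDiff (m₀ : PMoment d l) (hm₀ : IsDiscrete (m₀ : Measure (Euc d))) :
    IsGauge m₀ fun μ => ∫⁻ y, weight l y ∂(absDiff (μ : Measure (Euc d)) (m₀ : Measure (Euc d))) := by
  refine ⟨by simp [absDiff_self], ?_, ?_, ?_, ?_⟩
  · intro μ
    refine (lintegral_absDiff_le (add_comm _ _) _).trans_lt ?_
    exact ENNReal.add_lt_top.2 ⟨(lintegral_weight_ne_top μ).lt_top,
      (lintegral_weight_ne_top m₀).lt_top⟩
  · intro μ ν t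
    obtain ⟨κ₁, κ₂, _, _, h1, h2⟩ := exists_add_eq_absDiff (μ : Measure (Euc d)) (m₀ : Measure (Euc d))
    obtain ⟨κ₁', κ₂', _, _, h1', h2'⟩ :=
      exists_add_eq_absDiff (ν : Measure (Euc d)) (m₀ : Measure (Euc d))
    set a := ENNReal.ofReal (1 - (t : ℝ)) with ha
    set b := ENNReal.ofReal (t : ℝ) with hb
    have := Measure.smul_finite κ₁ (c := a) ENNReal.ofReal_ne_top
    have := Measure.smul_finite κ₂ (c := a) ENNReal.ofReal_ne_top
    have := Measure.smul_finite κ₁' (c := b) ENNReal.ofReal_ne_top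
    have := Measure.smul_finite κ₂' (c := b) ENNReal.ofReal_ne_top
    have h : (mix μ ν t : Measure (Euc d)) + (a • κ₂ + b • κ₂') =
        (m₀ : Measure (Euc d)) + (a • κ₁ + b • κ₁') := by
      rw [mix_coe, ← ha, ← hb, add_add_add_comm, ← smul_add, ← smul_add, h1, h1', smul_add,
        smul_add, add_add_add_comm, ofReal_mix_self]
    refine (lintegral_absDiff_le h _).trans ?_
    rw [← lintegral_add_measure, add_add_add_comm, ← smul_add, ← smul_add, ← h2, ← h2', lintegral_add_measure,
      lintegral_smul_measure, lintegral_smul_measure]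
    exact convexComb_le_max _ _ _
  · intro μ t
    obtain ⟨κ₁, κ₂, _, _, h1, h2⟩ := exists_add_eq_absDiff (μ : Measure (Euc d)) (m₀ : Measure (Euc d))
    set b := ENNReal.ofReal (t : ℝ) with hb
    have := Measure.smul_finite κ₁ (c := b) ENNReal.ofReal_ne_top
    have := Measure.smul_finite κ₂ (c := b) ENNReal.ofReal_ne_top
    have h : (mix m₀ μ t : Measure (Euc d)) + b • κ₂ = (m₀ : Measure (Euc d)) + b • κ₁ := by
      rw [mix_coe, ← hb, add_assoc, ← smul_add, h1, smul_add, ← add_assoc, ofReal_mix_self]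
    refine (lintegral_absDiff_le h _).trans ?_
    rw [← lintegral_add_measure, ← smul_add, ← h2, lintegral_smul_measure, smul_eq_mul]
  · obtain ⟨S, hS, hS0⟩ := hm₀
    obtain ⟨A, hAm, hAd, hAs, hAu⟩ : ∃ A : ℕ → Set (Euc d), (∀ j, MeasurableSet (A j)) ∧
        Pairwise (Function.onFun Disjoint A) ∧ (∀ j, (A j).Subsingleton) ∧ S ⊆ ⋃ j, A j := by
      rcases S.eq_empty_or_nonempty with rfl | hne
      · exact ⟨fun _ => ∅, by simp, fun _ _ _ => by simp [Function.onFun], by simp, by simp⟩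
      · obtain ⟨f, rfl⟩ := hS.exists_eq_range hne
        -- The enumeration of `S` may repeat points; disjointification turns the repetitions into
        -- empty cells.
        refine ⟨disjointed fun j => {f j}, fun j => MeasurableSet.disjointed
          (fun i => measurableSet_singleton _) j, disjoint_disjointed _,
          fun j => Set.subsingleton_singleton.anti (disjointed_subset _ j), ?_⟩
        rw [iUnion_disjointed, Set.iUnion_singleton_eq_range]
    refine ⟨testSets A, countable_testSets _, fun s => measurableSet_of_mem_testSets hAm, ?_⟩
    intro μ h1 h2
    refine ENNReal.tendsto_nhds_zero.2 fun η hη => ?_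
    have hm1 : ∀ j, A j ∈ testSets A := fun j => Or.inl ⟨j, rfl⟩
    obtain ⟨m, hm⟩ := exists_eventually_residualPart_lt hAm
        (measure_mono_null (Set.compl_subset_compl.2 hAu) hS0)
        (lintegral_weight_ne_top m₀) (fun j => h1 _ (hm1 j))
        (fun j => h2 _ (hm1 j)) (fun m => h2 _ (Or.inr ⟨m, rfl⟩)) hη
    filter_upwards [hm] with n hn
    have := isFiniteMeasure_of_le _ (residualPart_le (J := Finset.range m)
      (μ := (μ n : Measure (Euc d))) (ν := (m₀ : Measure (Euc d))) hAm hAd)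
    have := isFiniteMeasure_of_le _ (residualPart_le (J := Finset.range m)
      (μ := (m₀ : Measure (Euc d))) (ν := (μ n : Measure (Euc d))) hAm hAd)
    refine (lintegral_absDiff_le
      (κ₁ := residualPart A (Finset.range m) (μ n : Measure (Euc d)) (m₀ : Measure (Euc d)))
      (κ₂ := residualPart A (Finset.range m) (m₀ : Measure (Euc d)) (μ n : Measure (Euc d))) ?_
      _).trans ?_
    · have e₁ := matchedPart_add_residualPart (J := Finset.range m)
        (ν := (m₀ : Measure (Euc d))) (μ := (μ n : Measure (Euc d))) hAm hAd
      have e₂ := matchedPart_add_residualPart (J := Finset.range m)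
        (ν := (μ n : Measure (Euc d))) (μ := (m₀ : Measure (Euc d))) hAm hAd
      rw [← matchedPart_comm_of_subsingleton hAs] at e₂
      have h : ∀ {a b M r r' : Measure (Euc d)}, M + r = a → M + r' = b → a + r' = b + r := by
        rintro _ _ M r r' rfl rfl
        exact add_right_comm _ _ _
      exact h e₁ e₂
    · exact hn.le

lemma wasserstein_eq (μ ν : Measure (Euc d)) : wasserstein l μ ν =
    transportCost (fun p => ENNReal.ofReal (‖p.1 - p.2‖ ^ l)) μ ν ^ (1 / max l 1) := by
  have hp : 0 < 1 / max l 1 := by positivity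
  rw [← ENNReal.orderIsoRpow_apply _ hp, transportCost, OrderIso.map_iInf]
  simp_rw [OrderIso.map_iInf, ENNReal.orderIsoRpow_apply]
  rfl

lemma norm_sub_rpow_le {x y : Euc d} (hl : 0 ≤ l) :
    ‖x - y‖ ^ l ≤ 2 ^ l * ((1 + ‖x‖ ^ l) + (1 + ‖y‖ ^ l)) := by
  have h1 : ‖x - y‖ ≤ 2 * max ‖x‖ ‖y‖ := by
    linarith [norm_sub_le x y, le_max_left ‖x‖ ‖y‖, le_max_right ‖x‖ ‖y‖]
  have h2 : ‖x - y‖ ^ l ≤ 2 ^ l * (max ‖x‖ ‖y‖) ^ l := by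
    rw [← Real.mul_rpow (by norm_num) (by positivity)]
    exact Real.rpow_le_rpow (norm_nonneg _) h1 hl
  refine h2.trans (mul_le_mul_of_nonneg_left ?_ (by positivity))
  have hx : 0 ≤ ‖x‖ ^ l := by positivity
  have hy : 0 ≤ ‖y‖ ^ l := by positivity
  rcases max_cases ‖x‖ ‖y‖ with ⟨h, _⟩ | ⟨h, _⟩ <;> rw [h] <;> linarith

/-- The functional is kept apart from `D` because for `ℓ > 1` it is the transport cost, not its root
`W_ℓ`, that is sublinear on segments. The power `p` records the root. -/
lemma exists_isGauge (hl : 0 ≤ l) (m₀ : PMoment d l) : ∃ (T : PMoment d l → ℝ≥0∞) (p : ℝ), 0 < p ∧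
    IsGauge m₀ T ∧ ∀ μ, distD m₀ μ m₀ = T μ ^ p := by
  by_cases hm₀ : IsDiscrete (m₀ : Measure (Euc d))
  · refine ⟨_, 1, one_pos, isGauge_absDiff m₀ hm₀, fun μ => ?_⟩
    rw [distD, if_pos hm₀, ENNReal.rpow_one]
    rfl
  rcases hl.lt_or_eq with hl' | rfl
  · refine ⟨_, 1 / max l 1, by positivity, isGauge_transportCost m₀
      (c := fun p => ENNReal.ofReal (‖p.1 - p.2‖ ^ l)) (by fun_prop) ?_
      (K := ENNReal.ofReal (2 ^ l)) ENNReal.ofReal_ne_top ?_ ?_, fun μ => ?_⟩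
    · intro x; simp [Real.zero_rpow hl'.ne']
    · intro p
      rw [weight, weight, ← ENNReal.ofReal_add (by positivity) (by positivity),
        ← ENNReal.ofReal_mul (by positivity)]
      exact ENNReal.ofReal_le_ofReal (norm_sub_rpow_le hl)
    · intro η hη
      have h : Tendsto (fun t : ℝ => ENNReal.ofReal (t ^ l)) (𝓝 0) (𝓝 0) := by
        have h1 : Continuous fun t : ℝ => t ^ l := Real.continuous_rpow_const hl
        have h2 := (ENNReal.continuous_ofReal.comp h1).tendsto 0
        simpa [Function.comp_def, Real.zero_rpow hl'.ne'] using h2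
      obtain ⟨δ, hδ, h'⟩ := Metric.eventually_nhds_iff.1 (h.eventually (gt_mem_nhds hη))
      refine ⟨δ, hδ, fun x y hxy => (h' (y := ‖x - y‖) ?_).le⟩
      simpa [dist_eq_norm] using hxy
    · rw [distD, if_neg hm₀, if_pos hl', wasserstein_eq]
  · refine ⟨_, 1, one_pos, isGauge_transportCost m₀
      (c := fun p => ENNReal.ofReal (min ‖p.1 - p.2‖ 1)) (by fun_prop) ?_
      (K := 1) ENNReal.one_ne_top ?_ ?_, fun μ => ?_⟩
    · intro x; simp
    · intro p
      rw [one_mul]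
      refine le_trans ?_ ((one_le_weight p.1).trans le_self_add)
      exact ENNReal.ofReal_le_one.2 (min_le_right _ _)
    · intro η hη
      rcases eq_or_ne η ∞ with rfl | hη'
      · exact ⟨1, one_pos, by simp⟩
      refine ⟨η.toReal, ENNReal.toReal_pos hη.ne' hη', fun x y hxy => ?_⟩
      rw [← ENNReal.ofReal_toReal hη']
      refine ENNReal.ofReal_le_ofReal ((min_le_left _ _).trans ?_)
      rw [← dist_eq_norm]; exact hxy.le
    · rw [distD, if_neg hm₀, if_neg (lt_irrefl _), ENNReal.rpow_one]
      rfl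

end MeasureCLT

namespace MeasureCLT

variable {d : ℕ} {l : ℝ}

/-! ### Reparametrization of segments of measures -/

section Mix

lemma mix_mix_right (μ ν : PMoment d l) (s ε t : unitInterval)
    (h : (t : ℝ) = s + ε * (1 - s)) : mix (mix μ ν s) ν ε = mix μ ν t := by
  have hε : (0 : ℝ) ≤ 1 - ε := sub_nonneg.2 ε.2.2
  refine Subtype.ext ?_
  rw [mix_coe, mix_coe, mix_coe, smul_add, smul_smul, smul_smul, add_assoc, ← add_smul,
    ← ENNReal.ofReal_mul hε, ← ENNReal.ofReal_mul hε,
    ← ENNReal.ofReal_add (mul_nonneg hε s.2.1) ε.2.1,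
    show (1 - ε : ℝ) * (1 - s) = 1 - t by rw [h]; ring,
    show (1 - ε : ℝ) * s + ε = t by rw [h]; ring]

lemma mix_mix_left (μ ν : PMoment d l) (s ε t : unitInterval)
    (h : (t : ℝ) = s * (1 - ε)) : mix (mix μ ν s) μ ε = mix μ ν t := by
  have hε : (0 : ℝ) ≤ 1 - ε := sub_nonneg.2 ε.2.2
  have hs : (0 : ℝ) ≤ 1 - s := sub_nonneg.2 s.2.2
  refine Subtype.ext ?_
  rw [mix_coe, mix_coe, mix_coe, smul_add, smul_smul, smul_smul, add_right_comm, ← add_smul,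
    ← ENNReal.ofReal_mul hε, ← ENNReal.ofReal_mul hε,
    ← ENNReal.ofReal_add (mul_nonneg hε hs) ε.2.1,
    show (1 - ε : ℝ) * (1 - s) + ε = 1 - t by rw [h]; ring,
    show (1 - ε : ℝ) * s = t by rw [h]; ring]

lemma mix_zero (μ ν : PMoment d l) : mix μ ν 0 = μ := by
  refine Subtype.ext ?_
  simp [mix_coe]

lemma mix_one (μ ν : PMoment d l) : mix μ ν 1 = ν := by
  refine Subtype.ext ?_
  simp [mix_coe]

lemma integral_mix (μ ν : PMoment d l) (s : unitInterval) {f : Euc d → ℝ}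
    (hμ : Integrable f (μ : Measure (Euc d))) (hν : Integrable f (ν : Measure (Euc d))) :
    ∫ y, f y ∂(mix μ ν s : Measure (Euc d)) =
      (1 - s) * ∫ y, f y ∂(μ : Measure (Euc d)) + s * ∫ y, f y ∂(ν : Measure (Euc d)) := by
  rw [mix_coe, integral_add_measure (hμ.smul_measure ENNReal.ofReal_ne_top)
    (hν.smul_measure ENNReal.ofReal_ne_top), integral_smul_measure, integral_smul_measure,
    ENNReal.toReal_ofReal (sub_nonneg.2 s.2.2), ENNReal.toReal_ofReal s.2.1, smul_eq_mul,
    smul_eq_mul]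

end Mix

/-! ### Mean value theorem along segments -/

section Derivative

lemma IsLinearFunctionalDerivAt.integrable {U : PMoment d l → ℝ} {f : Euc d → ℝ}
    {μ : PMoment d l} (h : IsLinearFunctionalDerivAt U f μ) (ν : PMoment d l) :
    Integrable f (ν : Measure (Euc d)) := by
  obtain ⟨C, hC⟩ := h.2.1
  exact (((integrable_const 1).add ν.2.2).const_mul C).mono' h.1.aestronglyMeasurable
    (Eventually.of_forall hC)

variable {U : PMoment d l → ℝ} {μ ν : PMoment d l}

/-- Moving from an interior point of the segment towards `ν` follows the same segment at speed `1 -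
s`, and `ν - mix μ ν s` is `(1 - s)(ν - μ)`, so the factors cancel. The left derivative comes
likewise from moving towards `μ`. -/
lemma IsLinearFunctionalDerivAt.hasDerivWithinAt_Ici {f : Euc d → ℝ} {s : unitInterval}
    (h : IsLinearFunctionalDerivAt U f (mix μ ν s)) (hs : (s : ℝ) < 1) :
    HasDerivWithinAt (Set.IccExtend (zero_le_one' ℝ) fun ε => U (mix μ ν ε))
      (∫ y, f y ∂(ν : Measure (Euc d)) - ∫ y, f y ∂(μ : Measure (Euc d))) (Set.Ici s) s := by
  have h1 := h.2.2 ν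
  have hs' : 0 < 1 - (s : ℝ) := sub_pos.2 hs
  have hg : HasDerivWithinAt (fun x : ℝ => (x - s) / (1 - s)) (1 / (1 - s)) (Set.Ici (s : ℝ)) s :=
    (((hasDerivAt_id (s : ℝ)).sub_const _).div_const _).hasDerivWithinAt
  have h2 := HasDerivWithinAt.comp_of_eq (s : ℝ) h1 hg
    (fun x hx => div_nonneg (sub_nonneg.2 hx) hs'.le) (by simp)
  rw [integral_mix μ ν s (h.integrable μ) (h.integrable ν)] at h2
  refine (h2.congr_of_eventuallyEq ?_ ?_).congr_deriv ?_
  · have : ∀ᶠ x in 𝓝[Set.Ici (s : ℝ)] s, x ∈ Set.Icc (s : ℝ) 1 :=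
      Icc_mem_nhdsGE hs
    filter_upwards [this] with x hx
    have hx1 : x ∈ Set.Icc (0 : ℝ) 1 := ⟨s.2.1.trans hx.1, hx.2⟩
    have hx2 : (x - s) / (1 - s) ∈ Set.Icc (0 : ℝ) 1 :=
      ⟨div_nonneg (sub_nonneg.2 hx.1) hs'.le, (div_le_one hs').2 (by linarith [hx.2])⟩
    rw [Function.comp_apply, Set.IccExtend_of_mem _ _ hx1, Set.IccExtend_of_mem _ _ hx2]
    rw [mix_mix_right μ ν s _ ⟨x, hx1⟩ (by simp; field_simp; ring)]
  · have hx2 : ((s : ℝ) - s) / (1 - s) ∈ Set.Icc (0 : ℝ) 1 := by simp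
    rw [Function.comp_apply, Set.IccExtend_of_mem _ _ s.2, Set.IccExtend_of_mem _ _ hx2]
    rw [mix_mix_right μ ν s _ s (by simp)]
  · field_simp; ring

lemma IsLinearFunctionalDerivAt.hasDerivWithinAt_Iic {f : Euc d → ℝ} {s : unitInterval}
    (h : IsLinearFunctionalDerivAt U f (mix μ ν s)) (hs : 0 < (s : ℝ)) :
    HasDerivWithinAt (Set.IccExtend (zero_le_one' ℝ) fun ε => U (mix μ ν ε))
      (∫ y, f y ∂(ν : Measure (Euc d)) - ∫ y, f y ∂(μ : Measure (Euc d))) (Set.Iic s) s := by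
  have h1 := h.2.2 μ
  have hg : HasDerivWithinAt (fun x : ℝ => (s - x) / s) (-1 / s) (Set.Iic (s : ℝ)) s :=
    (((hasDerivAt_id (s : ℝ)).const_sub _).div_const _).hasDerivWithinAt
  have h2 := HasDerivWithinAt.comp_of_eq (s : ℝ) h1 hg
    (fun x hx => div_nonneg (sub_nonneg.2 hx) hs.le) (by simp)
  rw [integral_mix μ ν s (h.integrable μ) (h.integrable ν)] at h2
  refine (h2.congr_of_eventuallyEq ?_ ?_).congr_deriv ?_
  · have : ∀ᶠ x in 𝓝[Set.Iic (s : ℝ)] s, x ∈ Set.Icc 0 (s : ℝ) :=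
      Icc_mem_nhdsLE hs
    filter_upwards [this] with x hx
    have hx1 : x ∈ Set.Icc (0 : ℝ) 1 := ⟨hx.1, hx.2.trans s.2.2⟩
    have hx2 : (s - x) / s ∈ Set.Icc (0 : ℝ) 1 :=
      ⟨div_nonneg (sub_nonneg.2 hx.2) hs.le, (div_le_one hs).2 (by linarith [hx.1])⟩
    rw [Function.comp_apply, Set.IccExtend_of_mem _ _ hx1, Set.IccExtend_of_mem _ _ hx2]
    rw [mix_mix_left μ ν s _ ⟨x, hx1⟩ (by simp; field_simp; ring)]
  · have hx2 : ((s : ℝ) - s) / s ∈ Set.Icc (0 : ℝ) 1 := by simp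
    rw [Function.comp_apply, Set.IccExtend_of_mem _ _ s.2, Set.IccExtend_of_mem _ _ hx2]
    rw [mix_mix_left μ ν s _ s (by simp)]
  · field_simp; ring

/-- The two one-sided derivatives agree, so `U` is differentiable along the segment and Lagrange's
mean value theorem applies. Unlike an integral formula, it requires no regularity of the derivative
in `s`. -/
lemma exists_sub_eq_integral_sub {dU : PMoment d l → Euc d → ℝ}
    (h : ∀ s, IsLinearFunctionalDerivAt U (dU (mix μ ν s)) (mix μ ν s)) :
    ∃ s : unitInterval, U ν - U μ = ∫ y, dU (mix μ ν s) y ∂(ν : Measure (Euc d)) -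
      ∫ y, dU (mix μ ν s) y ∂(μ : Measure (Euc d)) := by
  set F := Set.IccExtend (zero_le_one' ℝ) fun ε => U (mix μ ν ε) with hF
  set F' := Set.IccExtend (zero_le_one' ℝ) fun s : Set.Icc (0 : ℝ) 1 =>
    ∫ y, dU (mix μ ν s) y ∂(ν : Measure (Euc d)) -
      ∫ y, dU (mix μ ν s) y ∂(μ : Measure (Euc d)) with hF'
  have hd : ∀ x ∈ Set.Ioo (0 : ℝ) 1, HasDerivAt F (F' x) x := by
    intro x hx
    have hx' : x ∈ Set.Icc (0 : ℝ) 1 := ⟨hx.1.le, hx.2.le⟩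
    have h1 := (h ⟨x, hx'⟩).hasDerivWithinAt_Ici hx.2
    have h2 := (h ⟨x, hx'⟩).hasDerivWithinAt_Iic hx.1
    have h3 := h2.union h1
    rw [hF', Set.IccExtend_of_mem _ _ hx']
    rw [Set.Iic_union_Ici] at h3
    exact h3.hasDerivAt univ_mem
  have hc : ContinuousOn F (Set.Icc 0 1) := by
    intro x hx
    rcases hx.1.eq_or_lt with h0 | h0
    · have := ((h ⟨x, hx⟩).hasDerivWithinAt_Ici (h0 ▸ one_pos)).continuousWithinAt
      exact this.mono (h0 ▸ Set.Icc_subset_Ici_self)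
    · have := ((h ⟨x, hx⟩).hasDerivWithinAt_Iic h0).continuousWithinAt
      rcases hx.2.eq_or_lt with h1 | h1
      · exact this.mono (h1 ▸ Set.Icc_subset_Iic_self)
      · exact (hd x ⟨h0, h1⟩).continuousAt.continuousWithinAt
  obtain ⟨x, hx, hxe⟩ := exists_hasDerivAt_eq_slope F F' one_pos hc hd
  have hx' : x ∈ Set.Icc (0 : ℝ) 1 := ⟨hx.1.le, hx.2.le⟩
  refine ⟨⟨x, hx'⟩, ?_⟩
  have h0 : F 0 = U μ := by
    rw [hF, Set.IccExtend_of_mem _ _ (Set.left_mem_Icc.2 zero_le_one)]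
    exact congrArg U (mix_zero μ ν)
  have h1 : F 1 = U ν := by
    rw [hF, Set.IccExtend_of_mem _ _ (Set.right_mem_Icc.2 zero_le_one)]
    exact congrArg U (mix_one μ ν)
  rw [h0, h1, sub_zero, div_one, hF', Set.IccExtend_of_mem _ _ hx'] at hxe
  exact hxe.symm

end Derivative

/-! ### A jointly measurable centered derivative -/

section CenteredDerivative

/-- The Dirac mass at `x` as an element of `𝒫_ℓ`. -/
noncomputable def diracP (l : ℝ) (x : Euc d) : PMoment d l :=
  ⟨Measure.dirac x, inferInstance, integrable_dirac (by simp)⟩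

/-- `1 / (n + 1)` as an element of the unit interval. -/
noncomputable def invSucc (n : ℕ) : unitInterval :=
  ⟨1 / ((n : ℝ) + 1), by positivity, by
    rw [div_le_one (by positivity)]; linarith [(Nat.cast_nonneg n : (0 : ℝ) ≤ n)]⟩

/-- The difference quotient `(n + 1) (U(μ + (δ_x - μ) / (n + 1)) - U(μ + (m₀ - μ) / (n + 1)))`. -/
noncomputable def diffQuotient (U : PMoment d l → ℝ) (m₀ : PMoment d l) (n : ℕ)
    (μ : PMoment d l) (x : Euc d) : ℝ :=
  (n + 1) * (U (mix μ (diracP l x) (invSucc n)) - U (mix μ m₀ (invSucc n)))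

/-- A jointly measurable version of `δU/δm(μ, x) - ∫ δU/δm(μ, y) m₀(dy)`. -/
noncomputable def centeredDeriv (U : PMoment d l → ℝ) (m₀ μ : PMoment d l) (x : Euc d) : ℝ :=
  (limsup (fun n => (diffQuotient U m₀ n μ x : EReal)) atTop).toReal

lemma measurable_mix (t : unitInterval) :
    Measurable fun p : PMoment d l × PMoment d l => mix p.1 p.2 t := by
  refine Measurable.subtype_mk (Measure.measurable_of_measurable_coe _ fun s hs => ?_)
  simp only [Measure.add_apply, Measure.smul_apply, smul_eq_mul]
  have h : Measurable fun μ : PMoment d l => (μ : Measure (Euc d)) s :=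
    (Measure.measurable_coe hs).comp measurable_subtype_coe
  exact ((h.comp measurable_fst).const_mul _).add ((h.comp measurable_snd).const_mul _)

lemma measurable_diracP : Measurable (diracP l : Euc d → PMoment d l) :=
  Measure.measurable_dirac.subtype_mk

/-- The difference quotients inherit joint measurability from `U`. The limsup is taken in `EReal` so
that it exists for every `μ`, including those at which `U` has no derivative. -/
lemma measurable_centeredDeriv {U : PMoment d l → ℝ} (hU : Measurable U) (m₀ : PMoment d l) :
    Measurable (Function.uncurry (centeredDeriv U m₀)) := by
  refine (Measurable.limsup fun n => ?_).ereal_toReal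
  refine Measurable.coe_real_ereal ?_
  refine Measurable.const_mul ?_ _
  refine (hU.comp ?_).sub (hU.comp ?_)
  · exact (measurable_mix (invSucc n)).comp
      (measurable_fst.prodMk (measurable_diracP.comp measurable_snd))
  · exact (measurable_mix (invSucc n)).comp (measurable_fst.prodMk measurable_const)

lemma IsLinearFunctionalDerivAt.tendsto {U : PMoment d l → ℝ} {f : Euc d → ℝ} {μ : PMoment d l}
    (h : IsLinearFunctionalDerivAt U f μ) (ν : PMoment d l) :
    Tendsto (fun n : ℕ => ((n : ℝ) + 1) * (U (mix μ ν (invSucc n)) - U μ)) atTop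
      (𝓝 (∫ y, f y ∂(ν : Measure (Euc d)) - ∫ y, f y ∂(μ : Measure (Euc d)))) := by
  have h1 := (h.2.2 ν).Ioi_of_Ici
  rw [hasDerivWithinAt_iff_tendsto_slope' (by simp)] at h1
  have h2 : Tendsto (fun n : ℕ => 1 / ((n : ℝ) + 1)) atTop (𝓝[>] 0) :=
    tendsto_nhdsWithin_iff.2 ⟨tendsto_one_div_add_atTop_nhds_zero_nat,
      Eventually.of_forall fun n => Set.mem_Ioi.2 (by positivity)⟩
  refine (h1.comp h2).congr fun n => ?_
  rw [Function.comp_apply, slope_def_field, sub_zero,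
    Set.IccExtend_of_mem _ _ (show 1 / ((n : ℝ) + 1) ∈ Set.Icc (0 : ℝ) 1 from (invSucc n).2), Set.IccExtend_of_mem _ _ (Set.left_mem_Icc.2 zero_le_one)]
  have h0 : mix μ ν ⟨0, Set.left_mem_Icc.2 zero_le_one⟩ = μ := mix_zero μ ν
  rw [h0, div_div_eq_mul_div, div_one, mul_comm]
  rfl

/-- Differentiating towards `δ_x` and towards `m₀` and subtracting cancels the integral against `μ`.
The result is independent of the additive constant in `f` and has mean zero under `m₀`. -/
lemma centeredDeriv_eq {U : PMoment d l → ℝ} {f : Euc d → ℝ} {μ : PMoment d l}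
    (h : IsLinearFunctionalDerivAt U f μ) (m₀ : PMoment d l) (x : Euc d) :
    centeredDeriv U m₀ μ x = f x - ∫ y, f y ∂(m₀ : Measure (Euc d)) := by
  have h1 := (h.tendsto (diracP l x)).sub (h.tendsto m₀)
  have h2 : Tendsto (fun n => diffQuotient U m₀ n μ x) atTop
      (𝓝 (f x - ∫ y, f y ∂(m₀ : Measure (Euc d)))) := by
    convert h1 using 2
    · rw [diffQuotient]; ring
    · have : ∫ y, f y ∂(diracP l x : Measure (Euc d)) = f x := integral_dirac f x
      rw [this]; ring
  have h3 : Tendsto (fun n => (diffQuotient U m₀ n μ x : EReal)) atTop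
      (𝓝 ((f x - ∫ y, f y ∂(m₀ : Measure (Euc d)) : ℝ) : EReal)) :=
    (continuous_coe_real_ereal.tendsto _).comp h2
  rw [centeredDeriv, h3.limsup_eq, EReal.toReal_coe]

end CenteredDerivative

/-! ### Moving a small mass from `m₀` to a point -/

section OneStep

/-- Leaving `κ` on the diagonal, only the mass `c` can move. -/
lemma wassersteinZero_add_smul_le (κ p q : Measure (Euc d)) [IsProbabilityMeasure p]
    [IsProbabilityMeasure q] (c : ℝ≥0∞) : wassersteinZero (κ + c • p) (κ + c • q) ≤ c := by
  have h := (isCoupling_diagCoupling κ).mix (isCoupling_prod p q) 1 c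
  rw [one_smul, one_smul] at h
  refine (iInf₂_le (f := fun ρ (_ : IsCoupling ρ (κ + c • p) (κ + c • q)) => ρ {p | p.1 ≠ p.2})
    _ h).trans ?_
  have hm : MeasurableSet {p : Euc d × Euc d | p.1 ≠ p.2} :=
    (measurableSet_eq_fun measurable_fst measurable_snd).compl
  rw [Measure.add_apply, diagCoupling, Measure.map_apply (by fun_prop) hm,
    Measure.smul_apply]
  simp only [Set.preimage_ofPred_eq, ne_eq, not_true_eq_false, Set.ofPred_false, measure_empty,
    zero_add, smul_eq_mul]
  exact mul_le_of_le_one_right' prob_le_one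

lemma integral_absDiff_add_smul_le (κ : Measure (Euc d)) [IsFiniteMeasure κ] (p q : PMoment d l)
    (c : ℝ) (hc : 0 ≤ c) (μ ν : PMoment d l)
    (hμ : (μ : Measure (Euc d)) = κ + ENNReal.ofReal c • (p : Measure (Euc d)))
    (hν : (ν : Measure (Euc d)) = κ + ENNReal.ofReal c • (q : Measure (Euc d))) :
    ∫ y, ‖y‖ ^ l ∂(absDiff (μ : Measure (Euc d)) (ν : Measure (Euc d))) ≤
      c * (∫ y, ‖y‖ ^ l ∂(p : Measure (Euc d)) + ∫ y, ‖y‖ ^ l ∂(q : Measure (Euc d))) := by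
  have := Measure.smul_finite (p : Measure (Euc d)) (c := ENNReal.ofReal c) ENNReal.ofReal_ne_top
  have := Measure.smul_finite (q : Measure (Euc d)) (c := ENNReal.ofReal c) ENNReal.ofReal_ne_top
  have h : (μ : Measure (Euc d)) + ENNReal.ofReal c • (q : Measure (Euc d)) =
      (ν : Measure (Euc d)) + ENNReal.ofReal c • (p : Measure (Euc d)) := by
    rw [hμ, hν, add_right_comm]
  have hp := p.2.2.smul_measure (c := ENNReal.ofReal c) ENNReal.ofReal_ne_top
  have hq := q.2.2.smul_measure (c := ENNReal.ofReal c) ENNReal.ofReal_ne_top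
  refine (integral_mono_measure (absDiff_le_add h)
    (Eventually.of_forall fun y => by positivity) (hp.add_measure hq)).trans ?_
  rw [integral_add_measure hp hq, integral_smul_measure, integral_smul_measure,
    ENNReal.toReal_ofReal hc, smul_eq_mul, smul_eq_mul, mul_add]

lemma rpow_le_one_add {t a : ℝ} (ht : 0 ≤ t) (ha0 : 0 ≤ a) (ha : a ≤ 1) : t ^ a ≤ 1 + t := by
  calc t ^ a ≤ (1 + t) ^ a := Real.rpow_le_rpow ht (by linarith) ha0
    _ ≤ (1 + t) ^ (1 : ℝ) := Real.rpow_le_rpow_of_exponent_le (by linarith) ha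
    _ = 1 + t := Real.rpow_one _

/-- The exponents `1 - α` and `α` add up to one, so the product grows only linearly in `a = |x|^ℓ`.
This is why moments of order `ℓ` suffice for the remainder. -/
lemma one_add_rpow_mul_rpow_le {a M α : ℝ} (ha : 0 ≤ a) (hM : 0 ≤ M) (h0 : 0 ≤ α) (h1 : α ≤ 1) :
    (1 + a ^ (1 - α)) * (a + M) ^ α ≤ 2 * (1 + a + M) := by
  have hQ : 0 < 1 + a + M := by linarith
  have e1 : a ^ (1 - α) ≤ (1 + a + M) ^ (1 - α) :=
    Real.rpow_le_rpow ha (by linarith) (by linarith)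
  have e2 : (1 : ℝ) ≤ (1 + a + M) ^ (1 - α) := Real.one_le_rpow (by linarith) (by linarith)
  have e3 : (a + M) ^ α ≤ (1 + a + M) ^ α := Real.rpow_le_rpow (by linarith) (by linarith) h0
  calc (1 + a ^ (1 - α)) * (a + M) ^ α
      ≤ (2 * (1 + a + M) ^ (1 - α)) * (1 + a + M) ^ α := by
        refine mul_le_mul (by linarith) e3 (by positivity) (by positivity)
    _ = 2 * ((1 + a + M) ^ ((1 - α) + α)) := by rw [Real.rpow_add hQ]; ring
    _ = 2 * (1 + a + M) := by rw [sub_add_cancel, Real.rpow_one]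

lemma mul_add_mul_le_abs_mul {C A B W V W' V' : ℝ} (hA : 0 ≤ A) (hB : 0 ≤ B) (hW : 0 ≤ W)
    (hV : 0 ≤ V) (hWW' : W ≤ W') (hVV' : V ≤ V') :
    C * (A * W + B * V) ≤ |C| * (A * W' + B * V') := by
  refine (mul_le_mul_of_nonneg_right (le_abs_self C) (by positivity)).trans ?_
  gcongr

/-- Second-order bound for the increment of `U` when a mass `c` is moved from `m₀` to `δ_x`. -/
lemma abs_sub_sub_centeredDeriv_le (m₀ : PMoment d l)
    {U : PMoment d l → ℝ} {dU : PMoment d l → Euc d → ℝ} {B : Set (PMoment d l)}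
    (h_deriv : ∀ μ ∈ B, IsLinearFunctionalDerivAt U (dU μ) μ) {α C : ℝ} (hα0 : 0 < α) (hα1 : α ≤ 1)
    (h_holder : ∀ μ₁ ∈ B, ∀ μ₂ ∈ B, ∀ x,
      |dU μ₂ x - dU μ₁ x| ≤ C * ((1 + ‖x‖ ^ l) *
        (wassersteinZero (μ₂ : Measure (Euc d)) (μ₁ : Measure (Euc d))).toReal ^ α +
        (1 + ‖x‖ ^ (l * (1 - α))) *
          (∫ y, ‖y‖ ^ l ∂(absDiff (μ₂ : Measure (Euc d)) (μ₁ : Measure (Euc d)))) ^ α))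
    {κ : Measure (Euc d)} [IsFiniteMeasure κ] {c : ℝ} (hc0 : 0 ≤ c) {x : Euc d}
    {μ ν : PMoment d l}
    (hμ : (μ : Measure (Euc d)) = κ + ENNReal.ofReal c • (m₀ : Measure (Euc d)))
    (hν : (ν : Measure (Euc d)) = κ + ENNReal.ofReal c • Measure.dirac x)
    (hB : ∀ s, mix μ ν s ∈ B) :
    |U ν - U μ - c * centeredDeriv U m₀ μ x| ≤
      c ^ (1 + α) * (|C| * (6 + ∫ y, ‖y‖ ^ l ∂(m₀ : Measure (Euc d))) *
        (1 + ‖x‖ ^ l + ∫ y, ‖y‖ ^ l ∂(m₀ : Measure (Euc d)))) := by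
  set M := ∫ y, ‖y‖ ^ l ∂(m₀ : Measure (Euc d)) with hM
  have hM0 : 0 ≤ M := integral_nonneg fun y => by positivity
  set a := ‖x‖ ^ l with ha
  have ha0 : 0 ≤ a := by positivity
  have haM : 0 ≤ a + M := add_nonneg ha0 hM0
  clear_value a M
  have hμB : μ ∈ B := mix_zero μ ν ▸ hB 0
  obtain ⟨s, hs⟩ := exists_sub_eq_integral_sub fun s => h_deriv _ (hB s)
  have hint : ∀ ρ ∈ B, ∫ y, dU ρ y ∂(ν : Measure (Euc d)) - ∫ y, dU ρ y ∂(μ : Measure (Euc d)) =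
      c * (dU ρ x - ∫ y, dU ρ y ∂(m₀ : Measure (Euc d))) := by
    intro ρ hρ
    have hi := fun ξ => (h_deriv ρ hρ).integrable ξ
    have hκ : Integrable (dU ρ) κ := (hi μ).mono_measure (hμ ▸ Measure.le_add_right le_rfl)
    have h1 : Integrable (dU ρ) (Measure.dirac x) := hi (diracP l x)
    rw [hμ, hν, integral_add_measure hκ (h1.smul_measure ENNReal.ofReal_ne_top),
      integral_add_measure hκ ((hi m₀).smul_measure ENNReal.ofReal_ne_top), integral_smul_measure,
      integral_smul_measure, ENNReal.toReal_ofReal hc0, integral_dirac, smul_eq_mul, smul_eq_mul]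
    ring
  have hbound : ∀ y, |dU (mix μ ν s) y - dU μ y| ≤
      |C| * c ^ α * ((1 + ‖y‖ ^ l) + (1 + ‖y‖ ^ (l * (1 - α))) * (a + M) ^ α) := by
    intro y
    have hcs : 0 ≤ c * s := mul_nonneg hc0 s.2.1
    have hcs' : c * s ≤ c := mul_le_of_le_one_right hc0 s.2.2
    have hs1 : (0 : ℝ) ≤ 1 - s := sub_nonneg.2 s.2.2
    -- The part common to `μ` and `mix μ ν s`, which differ only by a mass `c * s` sitting on `m₀`
    -- or on `δ_x`.
    set κ' := κ + ENNReal.ofReal (c * (1 - s)) • (m₀ : Measure (Euc d)) with hκ'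
    have := Measure.smul_finite (m₀ : Measure (Euc d)) (c := ENNReal.ofReal (c * (1 - s)))
      ENNReal.ofReal_ne_top
    have e1 : (mix μ ν s : Measure (Euc d)) =
        κ' + ENNReal.ofReal (c * s) • (diracP l x : Measure (Euc d)) := by
      rw [mix_coe, hμ, hν, smul_add, smul_add, add_add_add_comm, ofReal_mix_self, smul_smul,
        smul_smul, ← ENNReal.ofReal_mul hs1, ← ENNReal.ofReal_mul s.2.1, mul_comm _ c,
        mul_comm _ c, ← add_assoc]
      rfl
    have e2 : (μ : Measure (Euc d)) = κ' + ENNReal.ofReal (c * s) • (m₀ : Measure (Euc d)) := by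
      rw [hκ', add_assoc, ← add_smul, ← ENNReal.ofReal_add (mul_nonneg hc0 hs1) hcs, ← mul_add,
        sub_add_cancel, mul_one, hμ]
    have hW : (wassersteinZero (mix μ ν s : Measure (Euc d)) (μ : Measure (Euc d))).toReal ≤ c := by
      refine ENNReal.toReal_le_of_le_ofReal hc0 ?_
      conv_lhs => rw [e1, e2]
      exact (wassersteinZero_add_smul_le _ _ _ _).trans (ENNReal.ofReal_le_ofReal hcs')
    have hV : ∫ y, ‖y‖ ^ l ∂(absDiff (mix μ ν s : Measure (Euc d)) (μ : Measure (Euc d))) ≤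
        c * (a + M) := by
      refine (integral_absDiff_add_smul_le κ' _ _ (c * s) hcs _ _ e1 e2).trans ?_
      have : ∫ y, ‖y‖ ^ l ∂(diracP l x : Measure (Euc d)) = a :=
        (integral_dirac _ _).trans ha.symm
      rw [this, ← hM]
      exact mul_le_mul_of_nonneg_right hcs' haM
    have hV0 : 0 ≤ ∫ y, ‖y‖ ^ l ∂(absDiff (mix μ ν s : Measure (Euc d)) (μ : Measure (Euc d))) :=
      integral_nonneg fun y => by positivity
    have hV1 := Real.rpow_le_rpow hV0 hV hα0.le
    rw [Real.mul_rpow hc0 haM] at hV1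
    have hW1 := Real.rpow_le_rpow ENNReal.toReal_nonneg hW hα0.le
    refine (h_holder _ hμB _ (hB s) y).trans ?_
    refine (mul_add_mul_le_abs_mul (by positivity) (by positivity)
      (Real.rpow_nonneg ENNReal.toReal_nonneg _) (Real.rpow_nonneg hV0 _) hW1 hV1).trans
      (le_of_eq ?_)
    ring
  have hpow : ∀ y : Euc d, ‖y‖ ^ (l * (1 - α)) = (‖y‖ ^ l) ^ (1 - α) := fun y =>
    Real.rpow_mul (norm_nonneg y) _ _
  have hCc : 0 ≤ |C| * c ^ α := by positivity
  have hx : |dU (mix μ ν s) x - dU μ x| ≤ |C| * c ^ α * (3 * (1 + a + M)) := by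
    refine (hbound x).trans (mul_le_mul_of_nonneg_left ?_ hCc)
    have := one_add_rpow_mul_rpow_le ha0 hM0 hα0.le hα1
    rw [hpow x, ← ha]
    linarith
  -- The constants `3` at the point `x` and `3 + M` for the mean under `m₀` add up to the `6 + M` of
  -- the statement.
  have hm : |∫ y, (dU (mix μ ν s) y - dU μ y) ∂(m₀ : Measure (Euc d))| ≤
      |C| * c ^ α * ((3 + M) * (1 + a + M)) := by
    have hb : ∀ y, ‖dU (mix μ ν s) y - dU μ y‖ ≤
        |C| * c ^ α * ((1 + ‖y‖ ^ l) + (2 + ‖y‖ ^ l) * (1 + a + M)) := by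
      intro y
      refine (hbound y).trans (mul_le_mul_of_nonneg_left ?_ hCc)
      have e1 : (‖y‖ ^ l) ^ (1 - α) ≤ 1 + ‖y‖ ^ l :=
        rpow_le_one_add (by positivity) (by linarith) (by linarith)
      have e2 : (a + M) ^ α ≤ 1 + (a + M) := rpow_le_one_add (by positivity) hα0.le hα1
      rw [hpow y]
      refine add_le_add le_rfl (mul_le_mul (by linarith) (by linarith) (by positivity)
        (by positivity))
    have hJ : ∀ b : ℝ, Integrable (fun y => b + ‖y‖ ^ l) (m₀ : Measure (Euc d)) := fun b =>
      (integrable_const b).add m₀.2.2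
    have hJ' : ∀ b : ℝ, ∫ y, (b + ‖y‖ ^ l) ∂(m₀ : Measure (Euc d)) = b + M := fun b => by
      rw [integral_add (integrable_const b) m₀.2.2, ← hM]
      simp
    have hi : Integrable (fun y => |C| * c ^ α * ((1 + ‖y‖ ^ l) + (2 + ‖y‖ ^ l) * (1 + a + M)))
        (m₀ : Measure (Euc d)) := ((hJ 1).add ((hJ 2).mul_const _)).const_mul _
    refine (norm_integral_le_of_norm_le hi (Eventually.of_forall hb)).trans ?_
    rw [integral_const_mul, integral_add (hJ 1) ((hJ 2).mul_const _), integral_mul_const, hJ', hJ']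
    refine mul_le_mul_of_nonneg_left ?_ hCc
    nlinarith
  rw [centeredDeriv_eq (h_deriv μ hμB), hs, hint _ (hB s), ← mul_sub, abs_mul, abs_of_nonneg hc0]
  have e : dU (mix μ ν s) x - ∫ y, dU (mix μ ν s) y ∂(m₀ : Measure (Euc d)) -
      (dU μ x - ∫ y, dU μ y ∂(m₀ : Measure (Euc d))) = (dU (mix μ ν s) x - dU μ x) -
      ∫ y, (dU (mix μ ν s) y - dU μ y) ∂(m₀ : Measure (Euc d)) := by
    rw [integral_sub ((h_deriv _ (hB s)).integrable m₀) ((h_deriv _ hμB).integrable m₀)]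
    ring
  rw [e]
  rcases hc0.eq_or_lt with rfl | hc
  · rw [zero_mul]; positivity
  have e3 : c ^ (1 + α) = c * c ^ α := by rw [Real.rpow_add hc, Real.rpow_one]
  calc _ ≤ c * (|C| * c ^ α * (3 * (1 + a + M)) + |C| * c ^ α * ((3 + M) * (1 + a + M))) :=
        mul_le_mul_of_nonneg_left ((abs_sub _ _).trans (add_le_add hx hm)) hc0
    _ = _ := by rw [e3]; ring

end OneStep

end MeasureCLT

namespace MeasureCLT

/-! ### Orthogonality of martingale increments and approximation in probability -/

section Orthogonality

lemma lintegral_enorm_const_add_sq {E : Type*} [MeasurableSpace E] {m : Measure E}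
    [IsProbabilityMeasure m] {k : E → ℝ} (hk : Measurable k) {δ : ℝ≥0∞} (hδ : δ ≠ ∞)
    (h2 : ∫⁻ y, ‖k y‖ₑ ^ 2 ∂m ≤ δ) (h0 : ∫ y, k y ∂m = 0) (c : ℝ) :
    ∫⁻ y, ‖c + k y‖ₑ ^ 2 ∂m ≤ ‖c‖ₑ ^ 2 + δ := by
  have hL : MemLp k 2 m := by
    refine ⟨hk.aestronglyMeasurable, ?_⟩
    rw [eLpNorm_lt_top_iff_lintegral_rpow_enorm_lt_top (by simp) (by simp)]
    simpa using h2.trans_lt hδ.lt_top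
  have hi : Integrable k m := hL.integrable one_le_two
  have hi2 : Integrable (fun y => k y ^ 2) m := hL.integrable_sq
  have hsq : ∀ t : ℝ, ‖t‖ₑ ^ 2 = ENNReal.ofReal (t ^ 2) := fun t => by
    rw [← enorm_pow, Real.enorm_of_nonneg (sq_nonneg t)]
  have hi3 : Integrable (fun y => c ^ 2 + 2 * c * k y) m :=
    (integrable_const _).add (hi.const_mul _)
  have hi4 : Integrable (fun y => (c + k y) ^ 2) m := by
    refine (hi3.add hi2).congr (Eventually.of_forall fun y => ?_)
    simp only [Pi.add_apply]; ring
  have he : ∫ y, (c + k y) ^ 2 ∂m = c ^ 2 + ∫ y, k y ^ 2 ∂m := by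
    calc ∫ y, (c + k y) ^ 2 ∂m = ∫ y, ((c ^ 2 + 2 * c * k y) + k y ^ 2) ∂m := by
          congr with y; ring
      _ = _ := by
          rw [integral_add hi3 hi2, integral_add (integrable_const _) (hi.const_mul _),
            integral_const_mul, h0]
          simp
  simp_rw [hsq] at h2 ⊢
  rw [← ofReal_integral_eq_lintegral_ofReal hi2 (Eventually.of_forall fun _ => sq_nonneg _)] at h2
  rw [← ofReal_integral_eq_lintegral_ofReal hi4 (Eventually.of_forall fun _ => sq_nonneg _), he,
    ENNReal.ofReal_add (sq_nonneg c) (integral_nonneg fun _ => sq_nonneg _)]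
  exact add_le_add le_rfl h2

variable {Ω E : Type*} [MeasurableSpace Ω] [MeasurableSpace E] {P : Measure Ω}
  [IsProbabilityMeasure P] {m : Measure E} [IsProbabilityMeasure m]

/-- Independence lets `Y` be integrated out first with `X` frozen. The cross term vanishes because
each `k a` is centered under `m`. -/
lemma lintegral_enorm_add_sq_le_of_indepFun {A : Type*} [MeasurableSpace A] {X : Ω → A} {Y : Ω → E}
    (hX : Measurable X) (hY : Measurable Y) (hXY : IndepFun X Y P) (hYm : P.map Y = m)
    {F : A → ℝ} (hF : Measurable F) {k : A → E → ℝ} (hk : Measurable (Function.uncurry k))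
    {δ : ℝ≥0∞} (hδ : δ ≠ ∞) (h2 : ∀ a, ∫⁻ y, ‖k a y‖ₑ ^ 2 ∂m ≤ δ) (h0 : ∀ a, ∫ y, k a y ∂m = 0) :
    ∫⁻ ω, ‖F (X ω) + k (X ω) (Y ω)‖ₑ ^ 2 ∂P ≤ ∫⁻ ω, ‖F (X ω)‖ₑ ^ 2 ∂P + δ := by
  have hmap := (indepFun_iff_map_prod_eq_prod_map_map hX.aemeasurable hY.aemeasurable).1 hXY
  rw [hYm] at hmap
  have : IsProbabilityMeasure (P.map X) := Measure.isProbabilityMeasure_map hX.aemeasurable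
  have hG : Measurable fun p : A × E => ‖F p.1 + k p.1 p.2‖ₑ ^ 2 :=
    ((hF.comp measurable_fst).add hk).enorm.pow_const 2
  calc ∫⁻ ω, ‖F (X ω) + k (X ω) (Y ω)‖ₑ ^ 2 ∂P
      = ∫⁻ p, ‖F p.1 + k p.1 p.2‖ₑ ^ 2 ∂(P.map fun ω => (X ω, Y ω)) :=
        (lintegral_map hG (hX.prodMk hY)).symm
    _ = ∫⁻ a, ∫⁻ y, ‖F a + k a y‖ₑ ^ 2 ∂m ∂(P.map X) := by
        rw [hmap, lintegral_prod _ hG.aemeasurable]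
    _ ≤ ∫⁻ a, (‖F a‖ₑ ^ 2 + δ) ∂(P.map X) := lintegral_mono fun a =>
        lintegral_enorm_const_add_sq hk.of_uncurry_left hδ (h2 a) (h0 a) (F a)
    _ = _ := by
        rw [lintegral_add_right _ measurable_const, lintegral_const, measure_univ, mul_one,
          lintegral_map (hF.enorm.pow_const 2) hX]

/-- A sum of martingale increments of an i.i.d. sequence with conditional variances at most `δ`
has second moment at most `n δ`. -/
lemma lintegral_enorm_sum_sq_le {ζ : ℕ → Ω → E} (hζ : ∀ i, Measurable (ζ i))
    (hind : iIndepFun ζ P) (hlaw : ∀ i, P.map (ζ i) = m)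
    {k : ℕ → (ℕ → E) → E → ℝ} (hk : ∀ i, Measurable (Function.uncurry (k i)))
    (hdep : ∀ i z z', (∀ j < i, z j = z' j) → k i z = k i z') {δ : ℝ≥0∞} (hδ : δ ≠ ∞)
    (h2 : ∀ i z, ∫⁻ y, ‖k i z y‖ₑ ^ 2 ∂m ≤ δ) (h0 : ∀ i z, ∫ y, k i z y ∂m = 0) (n : ℕ) :
    ∫⁻ ω, ‖∑ i ∈ Finset.range n, k i (fun j => ζ j ω) (ζ i ω)‖ₑ ^ 2 ∂P ≤ n * δ := by
  induction n with
  | zero => simp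
  | succ n ih =>
    obtain ⟨e⟩ : Nonempty E := m.nonempty_of_neZero
    -- By `hdep` the terms see only finitely many coordinates, so padding the first `n` variables
    -- with an arbitrary point `e` expresses the past sum and the next kernel through the finite
    -- vector `X`, which is independent of `ζ n`.
    set ext : (Finset.range n → E) → ℕ → E := fun v j =>
      if h : j ∈ Finset.range n then v ⟨j, h⟩ else e with hext
    have hextm : Measurable ext := by
      refine measurable_pi_lambda _ fun j => ?_
      by_cases h : j ∈ Finset.range n
      · simp only [hext, h, dif_pos]; exact measurable_pi_apply _
      · simp only [hext, h]; exact measurable_const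
    set X : Ω → (Finset.range n → E) := fun ω i => ζ i ω with hX
    have hXm : Measurable X := measurable_pi_lambda _ fun i => hζ i
    have hXY : IndepFun X (ζ n) P := by
      have h := hind.indepFun_finset (Finset.range n) {n} (by simp) hζ
      exact h.comp (φ := id) (ψ := fun v : ({n} : Finset ℕ) → E => v ⟨n, by simp⟩)
        measurable_id (measurable_pi_apply _)
    have hag : ∀ ω, ∀ j < n, ext (X ω) j = ζ j ω := by
      intro ω j hj
      simp [hext, hX, hj]
    have hsum : ∀ ω, ∑ i ∈ Finset.range n, k i (fun j => ζ j ω) (ζ i ω) =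
        ∑ i ∈ Finset.range n, k i (ext (X ω)) (ext (X ω) i) := by
      intro ω
      refine Finset.sum_congr rfl fun i hi => ?_
      have hi' := Finset.mem_range.1 hi
      rw [hag ω i hi', hdep i _ (ext (X ω)) fun j hj => (hag ω j (hj.trans hi')).symm]
    have hF : Measurable fun v => ∑ i ∈ Finset.range n, k i (ext v) (ext v i) :=
      Finset.measurable_fun_sum _ fun i _ =>
        (hk i).comp (hextm.prodMk ((measurable_pi_apply i).comp hextm))
    have hkn : Measurable (Function.uncurry fun v y => k n (ext v) y) :=
      (hk n).comp ((hextm.comp measurable_fst).prodMk measurable_snd)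
    have hstep := lintegral_enorm_add_sq_le_of_indepFun hXm (hζ n) hXY (hlaw n) hF hkn hδ
      (fun v => h2 n (ext v)) (fun v => h0 n (ext v))
    simp_rw [← hsum] at hstep
    calc _ = ∫⁻ ω, ‖∑ i ∈ Finset.range n, k i (fun j => ζ j ω) (ζ i ω) +
          k n (ext (X ω)) (ζ n ω)‖ₑ ^ 2 ∂P := by
          congr with ω
          rw [Finset.sum_range_succ, hdep n _ (ext (X ω)) fun j hj => (hag ω j hj).symm]
      _ ≤ n * δ + δ := hstep.trans (add_le_add ih le_rfl)
      _ = _ := by push_cast; ring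

end Orthogonality

/-- Split `V` into `W` and `V - W`: Chebyshev's inequality controls the first, and almost sure
convergence the second. `W` may depend on the accuracy `δ`, as the truncation below does. -/
lemma tendstoInMeasure_zero_of_forall_approx {Ω : Type*} [MeasurableSpace Ω] {P : Measure Ω}
    [IsProbabilityMeasure P] {V : ℕ → Ω → ℝ} (hV : ∀ n, Measurable (V n))
    (h : ∀ δ : ℝ≥0∞, 0 < δ → δ ≠ ∞ → ∃ W : ℕ → Ω → ℝ, (∀ n, Measurable (W n)) ∧
      (∀ n, ∫⁻ ω, ‖W n ω‖ₑ ^ 2 ∂P ≤ δ) ∧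
      ∀ᵐ ω ∂P, Tendsto (fun n => V n ω - W n ω) atTop (𝓝 0)) :
    TendstoInMeasure P V atTop 0 := by
  refine tendstoInMeasure_iff_norm.2 fun ε hε => ENNReal.tendsto_nhds_zero.2 fun θ hθ => ?_
  rcases eq_or_ne θ ∞ with rfl | hθ'
  · simp
  have hε2 : 0 < ε / 2 := half_pos hε
  set e := ENNReal.ofReal (ε / 2) ^ 2 with he
  have he0 : e ≠ 0 := pow_ne_zero _ (ENNReal.ofReal_pos.2 hε2).ne'
  have hetop : e ≠ ∞ := ENNReal.pow_ne_top ENNReal.ofReal_ne_top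
  have hθ2 : 0 < θ / 2 := ENNReal.half_pos hθ.ne'
  -- With this second moment, Chebyshev's inequality at level `ε / 2` gives probability at most `θ /
  -- 2`.
  obtain ⟨W, hW, hW2, hVW⟩ := h (e * (θ / 2)) (ENNReal.mul_pos he0 hθ2.ne')
    (ENNReal.mul_ne_top hetop (ENNReal.div_ne_top hθ' (by simp)))
  have hm := tendstoInMeasure_of_tendsto_ae
    (fun n => ((hV n).sub (hW n)).aestronglyMeasurable) (g := fun _ => (0 : ℝ)) hVW
  rw [tendstoInMeasure_iff_norm] at hm
  filter_upwards [ENNReal.tendsto_nhds_zero.1 (hm _ hε2) _ hθ2] with n hn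
  have hW3 : P {ω | ε / 2 ≤ ‖W n ω‖} ≤ θ / 2 := by
    have h1 := mul_meas_ge_le_lintegral ((hW n).enorm.pow_const 2) (μ := P) e
    have h2 : {ω | ε / 2 ≤ ‖W n ω‖} ⊆ {ω | e ≤ ‖W n ω‖ₑ ^ 2} := by
      intro ω hω
      have : ENNReal.ofReal (ε / 2) ≤ ‖W n ω‖ₑ := by
        rw [← ofReal_norm]; exact ENNReal.ofReal_le_ofReal hω
      exact pow_le_pow_left' this 2
    exact (ENNReal.mul_le_mul_iff_right he0 hetop).1
      ((mul_le_mul_right (measure_mono h2) e).trans (h1.trans (hW2 n)))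
  have hsub : {ω | ε ≤ ‖V n ω - (0 : Ω → ℝ) ω‖} ⊆
      {ω | ε / 2 ≤ ‖(V n - W n) ω - 0‖} ∪ {ω | ε / 2 ≤ ‖W n ω‖} := by
    intro ω hω
    by_contra hcon
    simp only [Set.mem_union, Set.mem_ofPred_eq, not_or, not_le, sub_zero, Pi.sub_apply,
      Pi.zero_apply] at hcon hω
    have := norm_add_le (V n ω - W n ω) (W n ω)
    rw [sub_add_cancel] at this
    linarith [hcon.1, hcon.2]
  calc _ ≤ P ({ω | ε / 2 ≤ ‖(V n - W n) ω - 0‖} ∪ {ω | ε / 2 ≤ ‖W n ω‖}) := measure_mono hsub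
    _ ≤ θ / 2 + θ / 2 := (measure_union_le _ _).trans (add_le_add hn hW3)
    _ = θ := ENNReal.add_halves θ

/-! ### Hybrid measures between `m₀` and the empirical measure -/

section Hybrid

variable {d : ℕ} {l : ℝ}

/-- The measure `(1 / N) (∑_{j < i} δ_{z j} + (N - i) m₀)`, for `i ≤ N`. -/
noncomputable def hybrid (m₀ : PMoment d l) (z : ℕ → Euc d) (N : ℕ) [NeZero N] (i : ℕ) :
    PMoment d l :=
  ⟨(N : ℝ≥0∞)⁻¹ • ∑ j ∈ Finset.range N,
      if j < i then Measure.dirac (z j) else (m₀ : Measure (Euc d)), by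
    have hN : (N : ℝ≥0∞) ≠ 0 := Nat.cast_ne_zero.2 (NeZero.ne N)
    refine ⟨⟨?_⟩, ?_⟩
    · have h : ∀ j, (if j < i then Measure.dirac (z j) else (m₀ : Measure (Euc d))) Set.univ = 1 :=
        fun j => by split_ifs <;> simp
      simp [h, ENNReal.inv_mul_cancel hN (ENNReal.natCast_ne_top N)]
    · refine Integrable.smul_measure ?_ (ENNReal.inv_ne_top.2 hN)
      refine integrable_finsetSum_measure.2 fun j _ => ?_
      split_ifs
      · exact integrable_dirac (by simp)
      · exact m₀.2.2⟩

variable (m₀ : PMoment d l) (z : ℕ → Euc d) (N : ℕ) [NeZero N]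

lemma hybrid_coe (i : ℕ) : (hybrid m₀ z N i : Measure (Euc d)) =
    (N : ℝ≥0∞)⁻¹ • ∑ j ∈ Finset.range N,
      if j < i then Measure.dirac (z j) else (m₀ : Measure (Euc d)) := rfl

lemma empirical_coe : (empirical l z N : Measure (Euc d)) =
    (N : ℝ≥0∞)⁻¹ • ∑ i ∈ Finset.range N, Measure.dirac (z i) := rfl

lemma natCast_ne_zero_of_neZero : (N : ℝ≥0∞) ≠ 0 := Nat.cast_ne_zero.2 (NeZero.ne N)

lemma hybrid_zero : hybrid m₀ z N 0 = m₀ := by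
  refine Subtype.ext ?_
  rw [hybrid_coe]
  simp only [Nat.not_lt_zero, if_false, Finset.sum_const, Finset.card_range]
  rw [← Nat.cast_smul_eq_nsmul ℝ≥0∞, smul_smul,
    ENNReal.inv_mul_cancel (natCast_ne_zero_of_neZero N) (ENNReal.natCast_ne_top N), one_smul]

lemma hybrid_self : hybrid m₀ z N N = empirical l z N := by
  refine Subtype.ext ?_
  rw [hybrid_coe, empirical_coe]
  congr 1
  exact Finset.sum_congr rfl fun j hj => if_pos (Finset.mem_range.1 hj)

variable {z N} in
lemma hybrid_congr {z' : ℕ → Euc d} {i : ℕ} (h : ∀ j < i, z j = z' j) :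
    hybrid m₀ z N i = hybrid m₀ z' N i := by
  refine Subtype.ext ?_
  rw [hybrid_coe, hybrid_coe]
  congr 1
  refine Finset.sum_congr rfl fun j _ => ?_
  split_ifs with hj
  · rw [h j hj]
  · rfl

variable {N} in
lemma exists_hybrid_eq_add {i : ℕ} (hi : i < N) : ∃ κ : Measure (Euc d), IsFiniteMeasure κ ∧
    (hybrid m₀ z N i : Measure (Euc d)) =
      κ + ENNReal.ofReal ((N : ℝ)⁻¹) • (m₀ : Measure (Euc d)) ∧
    (hybrid m₀ z N (i + 1) : Measure (Euc d)) =
      κ + ENNReal.ofReal ((N : ℝ)⁻¹) • Measure.dirac (z i) := by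
  have hN : (0 : ℝ) < N := Nat.cast_pos.2 (Nat.pos_of_ne_zero (NeZero.ne N))
  have hc : ENNReal.ofReal ((N : ℝ)⁻¹) = (N : ℝ≥0∞)⁻¹ := by
    rw [ENNReal.ofReal_inv_of_pos hN, ENNReal.ofReal_natCast]
  have hi' := Finset.mem_range.2 hi
  set κ : Measure (Euc d) := (N : ℝ≥0∞)⁻¹ • ∑ j ∈ (Finset.range N).erase i,
    if j < i then Measure.dirac (z j) else (m₀ : Measure (Euc d)) with hκ
  have h1 : (hybrid m₀ z N i : Measure (Euc d)) =
      κ + ENNReal.ofReal ((N : ℝ)⁻¹) • (m₀ : Measure (Euc d)) := by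
    rw [hybrid_coe, hc, hκ, ← smul_add, ← Finset.sum_erase_add _ _ hi', if_neg (lt_irrefl i)]
  refine ⟨κ, ?_, h1, ?_⟩
  · exact isFiniteMeasure_of_le (hybrid m₀ z N i : Measure (Euc d))
      (h1 ▸ Measure.le_add_right le_rfl)
  · rw [hybrid_coe, hc, hκ, ← smul_add, ← Finset.sum_erase_add _ _ hi', if_pos (Nat.lt_succ_self i)]
    congr 2
    refine Finset.sum_congr rfl fun j hj => ?_
    have hne := Finset.ne_of_mem_erase hj
    have : j < i + 1 ↔ j < i := by omega
    simp only [this]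

/-- Grouping the atoms shows a hybrid to be a mixture of `m₀` and the empirical measure of its own
atoms. The index is shifted because an empirical measure needs at least one atom. -/
lemma exists_hybrid_eq_mix {i : ℕ} (hi : i + 1 ≤ N) : ∃ t : unitInterval,
    (t : ℝ) = (i + 1 : ℕ) / N ∧ hybrid m₀ z N (i + 1) = mix m₀ (empirical l z (i + 1)) t := by
  have hN : (0 : ℝ) < N := Nat.cast_pos.2 (Nat.pos_of_ne_zero (NeZero.ne N))
  have hle : ((i + 1 : ℕ) : ℝ) ≤ N := Nat.cast_le.2 hi
  refine ⟨⟨(i + 1 : ℕ) / N, by positivity, (div_le_one hN).2 hle⟩, rfl, Subtype.ext ?_⟩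
  rw [hybrid_coe, mix_coe, empirical_coe]
  have e1 : ENNReal.ofReal (((i + 1 : ℕ) : ℝ) / N) = (N : ℝ≥0∞)⁻¹ * ((i + 1 : ℕ) : ℝ≥0∞) := by
    rw [ENNReal.ofReal_div_of_pos hN, ENNReal.ofReal_natCast, ENNReal.ofReal_natCast,
      ENNReal.div_eq_inv_mul]
  have e2 : ENNReal.ofReal (1 - ((i + 1 : ℕ) : ℝ) / N) =
      (N : ℝ≥0∞)⁻¹ * ((N - (i + 1) : ℕ) : ℝ≥0∞) := by
    have : 1 - ((i + 1 : ℕ) : ℝ) / N = ((N - (i + 1) : ℕ) : ℝ) / N := by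
      rw [Nat.cast_sub hi]; field_simp
    rw [this, ENNReal.ofReal_div_of_pos hN, ENNReal.ofReal_natCast, ENNReal.ofReal_natCast,
      ENNReal.div_eq_inv_mul]
  simp only [e1, e2]
  rw [mul_smul, mul_smul, ← smul_add, smul_smul ((i + 1 : ℕ) : ℝ≥0∞),
    ENNReal.mul_inv_cancel (natCast_ne_zero_of_neZero (i + 1)) (ENNReal.natCast_ne_top _), one_smul]
  congr 1
  obtain ⟨r, hr⟩ := Nat.exists_eq_add_of_le hi
  rw [hr, Finset.sum_range_add, add_tsub_cancel_left, add_comm]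
  congr 1
  · rw [Finset.sum_congr rfl fun j _ => if_neg (by omega), Finset.sum_const, Finset.card_range,
      Nat.cast_smul_eq_nsmul]
  · exact Finset.sum_congr rfl fun j hj => if_pos (Finset.mem_range.1 hj)

lemma measurable_hybrid (i : ℕ) : Measurable fun z : ℕ → Euc d => hybrid m₀ z N i := by
  refine Measurable.subtype_mk (Measure.measurable_of_measurable_coe _ fun s hs => ?_)
  simp only [Measure.smul_apply, smul_eq_mul, Measure.finsetSum_apply]
  refine (Finset.measurable_fun_sum _ fun j _ => ?_).const_mul _
  split_ifs
  · exact (Measure.measurable_coe hs).comp (Measure.measurable_dirac.comp (measurable_pi_apply j))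
  · exact measurable_const

lemma lintegral_empirical (f : Euc d → ℝ≥0∞) : ∫⁻ x, f x ∂(empirical l z N : Measure (Euc d)) =
    (N : ℝ≥0∞)⁻¹ * ∑ i ∈ Finset.range N, f (z i) := by
  rw [empirical_coe, lintegral_smul_measure, lintegral_finsetSum_measure, smul_eq_mul]
  simp

variable {m₀ z} in
/-- If the gauge tends to zero along the empirical measures, then it does so uniformly along the
hybrid measures. -/
lemma IsGauge.eventually_forall_hybrid_lt {T : PMoment d l → ℝ≥0∞} (hT : IsGauge m₀ T)
    (h : Tendsto (fun n : ℕ => T (empirical l z (n + 1))) atTop (𝓝 0)) {η : ℝ≥0∞} (hη : 0 < η) :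
    ∀ᶠ n : ℕ in atTop, ∀ i ≤ n + 1, T (hybrid m₀ z (n + 1) i) < η := by
  -- Beyond `K` atoms the empirical measure is already close to `m₀`. For the finitely many smaller
  -- hybrids, the mixing weight `(i + 1) / (n + 1)` tends to zero.
  obtain ⟨K, hK⟩ := eventually_atTop.1 (h.eventually (gt_mem_nhds hη))
  have hlim : ∀ i : ℕ, Tendsto (fun n : ℕ => ENNReal.ofReal (((i + 1 : ℕ) : ℝ) / (n + 1 : ℕ)) *
      T (empirical l z (i + 1))) atTop (𝓝 0) := by
    intro i
    have h1 : Tendsto (fun n : ℕ => ((i + 1 : ℕ) : ℝ) / (n + 1 : ℕ)) atTop (𝓝 0) :=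
      (tendsto_const_div_atTop_nhds_zero_nat ((i + 1 : ℕ) : ℝ)).comp (tendsto_add_atTop_nat 1)
    have h2 := ENNReal.Tendsto.mul_const (ENNReal.tendsto_ofReal h1)
      (Or.inr (hT.lt_top (empirical l z (i + 1))).ne)
    simpa using h2
  have hfin : ∀ᶠ n : ℕ in atTop, ∀ i ∈ Finset.range K,
      ENNReal.ofReal (((i + 1 : ℕ) : ℝ) / (n + 1 : ℕ)) * T (empirical l z (i + 1)) < η :=
    (Finset.eventually_all _).2 fun i _ => (hlim i).eventually (gt_mem_nhds hη)
  filter_upwards [hfin] with n hn i hi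
  rcases i with _ | i
  · rw [hybrid_zero, hT.self]; exact hη
  · obtain ⟨t, ht, he⟩ := exists_hybrid_eq_mix m₀ z (n + 1) hi
    rw [he]
    refine (hT.mix_le _ t).trans_lt ?_
    rcases lt_or_ge i K with hiK | hiK
    · rw [ht]; exact hn i (Finset.mem_range.2 hiK)
    · refine lt_of_le_of_lt (mul_le_of_le_one_left' ?_) (hK i hiK)
      exact ENNReal.ofReal_le_one.2 t.2.2

end Hybrid

/-! ### Almost sure convergence of empirical measures -/

section LawOfLargeNumbers

variable {d : ℕ} {l : ℝ} {m₀ : PMoment d l} {Ω : Type*} [MeasurableSpace Ω] {P : Measure Ω}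
  {ζ : ℕ → Ω → Euc d}

lemma ae_tendsto_average (hζ : ∀ i, Measurable (ζ i)) (hind : iIndepFun ζ P)
    (hlaw : ∀ i, P.map (ζ i) = (m₀ : Measure (Euc d))) {f : Euc d → ℝ} (hf : Measurable f)
    (hfi : Integrable f (m₀ : Measure (Euc d))) :
    ∀ᵐ ω ∂P, Tendsto (fun n : ℕ => (∑ i ∈ Finset.range n, f (ζ i ω)) / n) atTop
      (𝓝 (∫ x, f x ∂(m₀ : Measure (Euc d)))) := by
  have h := strong_law_ae_real (μ := P) (fun i ω => f (ζ i ω))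
    ((integrable_map_measure (hlaw 0 ▸ hfi.aestronglyMeasurable) (hζ 0).aemeasurable).1
      (hlaw 0 ▸ hfi))
    (fun i j hij => (hind.indepFun hij).comp hf hf)
    (fun i => IdentDistrib.comp ⟨(hζ i).aemeasurable, (hζ 0).aemeasurable, by rw [hlaw, hlaw]⟩ hf)
  have h2 : ∫ ω, f (ζ 0 ω) ∂P = ∫ x, f x ∂(m₀ : Measure (Euc d)) := by
    rw [← hlaw 0, integral_map (hζ 0).aemeasurable hf.aestronglyMeasurable]
  rwa [h2] at h

lemma ae_tendsto_lintegral_empirical (hζ : ∀ i, Measurable (ζ i)) (hind : iIndepFun ζ P)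
    (hlaw : ∀ i, P.map (ζ i) = (m₀ : Measure (Euc d))) {f : Euc d → ℝ} (hf : Measurable f)
    (hf0 : ∀ x, 0 ≤ f x) (hfi : Integrable f (m₀ : Measure (Euc d))) :
    ∀ᵐ ω ∂P, Tendsto (fun n : ℕ => ∫⁻ x, ENNReal.ofReal (f x)
      ∂(empirical l (fun i => ζ i ω) (n + 1) : Measure (Euc d))) atTop
      (𝓝 (∫⁻ x, ENNReal.ofReal (f x) ∂(m₀ : Measure (Euc d)))) := by
  filter_upwards [ae_tendsto_average hζ hind hlaw hf hfi] with ω hω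
  rw [← ofReal_integral_eq_lintegral_ofReal hfi (Eventually.of_forall hf0)]
  refine (ENNReal.tendsto_ofReal (hω.comp (tendsto_add_atTop_nat 1))).congr fun n => ?_
  rw [lintegral_empirical, Function.comp_apply, ENNReal.ofReal_div_of_pos (by positivity),
    ENNReal.ofReal_sum_of_nonneg fun i _ => hf0 _, ENNReal.ofReal_natCast, ENNReal.div_eq_inv_mul]

/-- The strong law applies to the mass and the weighted mass of each test set. Countability of the
family provides one almost sure event for all of them. -/
lemma IsGauge.ae_tendsto_empirical {T : PMoment d l → ℝ≥0∞} (hT : IsGauge m₀ T)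
    (hζ : ∀ i, Measurable (ζ i)) (hind : iIndepFun ζ P)
    (hlaw : ∀ i, P.map (ζ i) = (m₀ : Measure (Euc d))) :
    ∀ᵐ ω ∂P, Tendsto (fun n : ℕ => T (empirical l (fun i => ζ i ω) (n + 1))) atTop (𝓝 0) := by
  obtain ⟨𝒜, h𝒜, hm, hT'⟩ := hT.tendsto
  have h1 : ∀ᵐ ω ∂P, ∀ A ∈ 𝒜, Tendsto (fun n : ℕ =>
      (empirical l (fun i => ζ i ω) (n + 1) : Measure (Euc d)) A) atTop
      (𝓝 ((m₀ : Measure (Euc d)) A)) := by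
    refine (ae_ball_iff h𝒜).2 fun A hA => ?_
    have h := ae_tendsto_lintegral_empirical hζ hind hlaw (f := A.indicator fun _ => 1)
      (measurable_const.indicator (hm A hA)) (Set.indicator_nonneg fun _ _ => zero_le_one)
      ((integrable_const 1).indicator (hm A hA))
    have e : ∀ x, ENNReal.ofReal (A.indicator (fun _ => (1 : ℝ)) x) =
        A.indicator 1 x := fun x => by
      by_cases hx : x ∈ A <;> simp [hx]
    simp_rw [e, lintegral_indicator_one (hm A hA)] at h
    exact h
  have h2 : ∀ᵐ ω ∂P, ∀ A ∈ 𝒜, Tendsto (fun n : ℕ => ∫⁻ x in A, weight l x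
      ∂(empirical l (fun i => ζ i ω) (n + 1) : Measure (Euc d))) atTop
      (𝓝 (∫⁻ x in A, weight l x ∂(m₀ : Measure (Euc d)))) := by
    refine (ae_ball_iff h𝒜).2 fun A hA => ?_
    have h := ae_tendsto_lintegral_empirical hζ hind hlaw
      (f := A.indicator fun x => 1 + ‖x‖ ^ l)
      (Measurable.indicator (by fun_prop) (hm A hA))
      (Set.indicator_nonneg fun _ _ => by positivity)
      (((integrable_const 1).add m₀.2.2).indicator (hm A hA))
    have e : ∀ x, ENNReal.ofReal (A.indicator (fun x => 1 + ‖x‖ ^ l) x) =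
        A.indicator (weight l) x := fun x => by
      by_cases hx : x ∈ A <;> simp [hx, weight]
    simp_rw [e, lintegral_indicator (hm A hA)] at h
    exact h
  filter_upwards [h1, h2] with ω hω1 hω2
  exact hT' _ hω1 hω2

end LawOfLargeNumbers

end MeasureCLT

namespace MeasureCLT

/-! ### Increments of the derivative and their truncation -/

variable {d : ℕ} {l : ℝ}

lemma memLp_norm_rpow_half (μ : PMoment d l) :
    MemLp (fun x => ‖x‖ ^ (l / 2)) 2 (μ : Measure (Euc d)) := by
  refine (memLp_two_iff_integrable_sq (Measurable.aestronglyMeasurable (by fun_prop))).2 ?_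
  refine μ.2.2.congr (Eventually.of_forall fun x => ?_)
  simp only
  rw [← Real.rpow_natCast, ← Real.rpow_mul (norm_nonneg x)]
  congr 1
  norm_num

lemma measurable_uncurry_hybrid (m₀ : PMoment d l) (N i : ℕ) [NeZero N]
    {f : PMoment d l → Euc d → ℝ} (hf : Measurable (Function.uncurry f)) :
    Measurable (Function.uncurry fun (z : ℕ → Euc d) (x : Euc d) => f (hybrid m₀ z N i) x) := by
  have h1 : Measurable fun p : (ℕ → Euc d) × Euc d => hybrid m₀ p.1 N i :=
    (measurable_hybrid m₀ N i).comp measurable_fst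
  exact hf.comp (h1.prodMk measurable_snd)

/-- The difference of the centered derivatives at `μ` and `m₀`. -/
noncomputable def derivDiff (U : PMoment d l → ℝ) (m₀ μ : PMoment d l) (x : Euc d) : ℝ :=
  centeredDeriv U m₀ μ x - centeredDeriv U m₀ m₀ x

/-- The measures at which `derivDiff` is centered with variance at most `δ` under `m₀`. -/
def goodSet (U : PMoment d l → ℝ) (m₀ : PMoment d l) (δ : ℝ≥0∞) : Set (PMoment d l) :=
  {μ | ∫⁻ x, ‖derivDiff U m₀ μ x‖ₑ ^ 2 ∂(m₀ : Measure (Euc d)) ≤ δ ∧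
    ∫ x, derivDiff U m₀ μ x ∂(m₀ : Measure (Euc d)) = 0}

section Measurability

variable {U : PMoment d l → ℝ}

lemma measurable_derivDiff (hU : Measurable U) (m₀ : PMoment d l) :
    Measurable (Function.uncurry (derivDiff U m₀)) := by
  have h1 : Measurable (centeredDeriv U m₀ m₀) := (measurable_centeredDeriv hU m₀).of_uncurry_left
  have h2 : Measurable fun p : PMoment d l × Euc d => centeredDeriv U m₀ m₀ p.2 :=
    h1.comp measurable_snd
  exact (measurable_centeredDeriv hU m₀).sub h2

/-- The good set is defined through `centeredDeriv` and not through the given derivative, so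
Fubini-type measurability applies. This makes the truncated increments measurable. -/
lemma measurableSet_goodSet (hU : Measurable U) (m₀ : PMoment d l) (δ : ℝ≥0∞) :
    MeasurableSet (goodSet U m₀ δ) := by
  have h := measurable_derivDiff hU m₀
  refine (measurableSet_le (Measurable.lintegral_prod_right' (f := fun p : PMoment d l × Euc d =>
    ‖derivDiff U m₀ p.1 p.2‖ₑ ^ 2) (h.enorm.pow_const 2)) measurable_const).inter ?_
  exact (h.stronglyMeasurable.integral_prod_right (ν := (m₀ : Measure (Euc d)))).measurable
    (measurableSet_singleton 0)

end Measurability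

section GoodSet

variable {U : PMoment d l → ℝ} {m₀ : PMoment d l} {dU : PMoment d l → Euc d → ℝ} {B : Set (PMoment d l)}

lemma derivDiff_eq (h_deriv : ∀ μ ∈ B, IsLinearFunctionalDerivAt U (dU μ) μ) (hm₀ : m₀ ∈ B)
    {μ : PMoment d l} (hμ : μ ∈ B) (x : Euc d) : derivDiff U m₀ μ x =
      (dU μ x - dU m₀ x) - ∫ y, (dU μ y - dU m₀ y) ∂(m₀ : Measure (Euc d)) := by
  rw [derivDiff, centeredDeriv_eq (h_deriv μ hμ), centeredDeriv_eq (h_deriv m₀ hm₀),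
    integral_sub ((h_deriv μ hμ).integrable m₀) ((h_deriv m₀ hm₀).integrable m₀)]
  ring

/-- Centering a function bounded by `e (1 + |x|^(ℓ/2))` adds at most `e M`, so the second moment is
at most `e ^ 2 * V`, with `V` finite because `m₀` has a moment of order `ℓ`. -/
lemma exists_forall_mem_goodSet (h_deriv : ∀ μ ∈ B, IsLinearFunctionalDerivAt U (dU μ) μ)
    (hm₀ : m₀ ∈ B) {δ : ℝ≥0∞} (hδ : 0 < δ) : ∃ e : ℝ, 0 < e ∧ ∀ μ ∈ B,
      (∀ x, |dU μ x - dU m₀ x| ≤ e * (1 + ‖x‖ ^ (l / 2))) → μ ∈ goodSet U m₀ δ := by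
  have hL := memLp_norm_rpow_half m₀
  have hi : Integrable (fun x => 1 + ‖x‖ ^ (l / 2)) (m₀ : Measure (Euc d)) :=
    (integrable_const 1).add (hL.integrable one_le_two)
  set M := ∫ x, (1 + ‖x‖ ^ (l / 2)) ∂(m₀ : Measure (Euc d)) with hM
  have hM0 : 0 ≤ M := integral_nonneg fun x => by positivity
  have hL2 : MemLp (fun x => (1 + M) + ‖x‖ ^ (l / 2)) 2 (m₀ : Measure (Euc d)) :=
    (memLp_const (1 + M)).add hL
  set V := ∫⁻ x, ‖(1 + M) + ‖x‖ ^ (l / 2)‖ₑ ^ 2 ∂(m₀ : Measure (Euc d)) with hV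
  have hVtop : V ≠ ∞ := by
    have := hL2.2
    rw [eLpNorm_lt_top_iff_lintegral_rpow_enorm_lt_top (by simp) (by simp)] at this
    simpa using this.ne
  have hlim : Tendsto (fun e : ℝ => ‖e‖ₑ ^ 2 * V) (𝓝[>] 0) (𝓝 0) := by
    have h1 : Tendsto (fun e : ℝ => ‖e‖ₑ ^ 2) (𝓝 0) (𝓝 0) := by
      have : Continuous fun e : ℝ => ‖e‖ₑ ^ 2 := (ENNReal.continuous_pow 2).comp continuous_enorm
      simpa using this.tendsto 0
    have h2 := ENNReal.Tendsto.mul_const h1 (Or.inr hVtop)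
    rw [zero_mul] at h2
    exact h2.mono_left nhdsWithin_le_nhds
  obtain ⟨e, he, he0⟩ := ((ENNReal.tendsto_nhds_zero.1 hlim δ hδ).and self_mem_nhdsWithin).exists
  refine ⟨e, he0, fun μ hμ hx => ?_⟩
  have he0' : (0 : ℝ) ≤ e := le_of_lt he0
  have hint : |∫ y, (dU μ y - dU m₀ y) ∂(m₀ : Measure (Euc d))| ≤ e * M := by
    rw [hM, ← integral_const_mul]
    exact norm_integral_le_of_norm_le (f := fun y => dU μ y - dU m₀ y) (hi.const_mul e)
      (Eventually.of_forall hx)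
  constructor
  · refine le_trans ?_ he
    rw [hV, ← lintegral_const_mul' _ _ (by simp)]
    refine lintegral_mono fun x => ?_
    rw [← mul_pow, ← enorm_mul]
    refine pow_le_pow_left' ?_ 2
    rw [derivDiff_eq h_deriv hm₀ hμ, enorm_le_iff_norm_le, Real.norm_eq_abs, Real.norm_eq_abs,
      abs_of_nonneg (mul_nonneg he0' (by positivity))]
    refine (abs_sub _ _).trans ((add_le_add (hx x) hint).trans (le_of_eq ?_))
    ring
  · simp_rw [derivDiff_eq h_deriv hm₀ hμ]
    have hd : Integrable (fun x => dU μ x - dU m₀ x) (m₀ : Measure (Euc d)) :=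
      ((h_deriv μ hμ).integrable m₀).sub ((h_deriv m₀ hm₀).integrable m₀)
    rw [integral_sub hd (integrable_const _)]
    simp

end GoodSet

section Truncation

variable {U : PMoment d l → ℝ} {m₀ : PMoment d l} {δ : ℝ≥0∞}

open Classical in
/-- `derivDiff`, set to zero outside of `goodSet`. -/
noncomputable def truncDiff (U : PMoment d l → ℝ) (m₀ : PMoment d l) (δ : ℝ≥0∞)
    (μ : PMoment d l) (x : Euc d) : ℝ :=
  if μ ∈ goodSet U m₀ δ then derivDiff U m₀ μ x else 0

lemma measurable_truncDiff (hU : Measurable U) :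
    Measurable (Function.uncurry (truncDiff U m₀ δ)) :=
  Measurable.ite (measurable_fst (measurableSet_goodSet hU m₀ δ)) (measurable_derivDiff hU m₀)
    measurable_const

lemma lintegral_truncDiff_le (μ : PMoment d l) :
    ∫⁻ x, ‖truncDiff U m₀ δ μ x‖ₑ ^ 2 ∂(m₀ : Measure (Euc d)) ≤ δ := by
  by_cases h : μ ∈ goodSet U m₀ δ
  · simpa only [truncDiff, if_pos h] using h.1
  · simp [truncDiff, h]

lemma integral_truncDiff (μ : PMoment d l) :
    ∫ x, truncDiff U m₀ δ μ x ∂(m₀ : Measure (Euc d)) = 0 := by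
  by_cases h : μ ∈ goodSet U m₀ δ
  · simpa only [truncDiff, if_pos h] using h.2
  · simp [truncDiff, h]

variable {Ω : Type*} [MeasurableSpace Ω] {P : Measure Ω} [IsProbabilityMeasure P]
  {ζ : ℕ → Ω → Euc d}

/-- After truncation, centering and the variance bound hold at every measure, so orthogonality
applies without conditioning on the hybrids being close to `m₀`. -/
lemma lintegral_sum_truncDiff_le (hU : Measurable U) (hδ : δ ≠ ∞) (hζ : ∀ i, Measurable (ζ i))
    (hind : iIndepFun ζ P) (hlaw : ∀ i, P.map (ζ i) = (m₀ : Measure (Euc d))) (n : ℕ) :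
    ∫⁻ ω, ‖(√((n + 1 : ℕ) : ℝ))⁻¹ * ∑ i ∈ Finset.range (n + 1),
      truncDiff U m₀ δ (hybrid m₀ (fun j => ζ j ω) (n + 1) i) (ζ i ω)‖ₑ ^ 2 ∂P ≤ δ := by
  have hk : ∀ i, Measurable (Function.uncurry fun (z : ℕ → Euc d) (x : Euc d) =>
      truncDiff U m₀ δ (hybrid m₀ z (n + 1) i) x) := fun i =>
    measurable_uncurry_hybrid m₀ (n + 1) i (measurable_truncDiff hU)
  have hdep : ∀ (i : ℕ) (z z' : ℕ → Euc d), (∀ j < i, z j = z' j) →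
      truncDiff U m₀ δ (hybrid m₀ z (n + 1) i) = truncDiff U m₀ δ (hybrid m₀ z' (n + 1) i) :=
    fun i z z' hz => congrArg _ (hybrid_congr m₀ hz)
  have h := lintegral_enorm_sum_sq_le hζ hind hlaw
    (k := fun i z x => truncDiff U m₀ δ (hybrid m₀ z (n + 1) i) x)
    hk hdep hδ
    (fun i z => lintegral_truncDiff_le (hybrid m₀ z (n + 1) i))
    (fun i z => integral_truncDiff (hybrid m₀ z (n + 1) i)) (n + 1)
  have hc : ‖(√((n + 1 : ℕ) : ℝ))⁻¹‖ₑ ^ 2 = ((n + 1 : ℕ) : ℝ≥0∞)⁻¹ := by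
    rw [← enorm_pow, inv_pow, Real.sq_sqrt (by positivity), Real.enorm_of_nonneg (by positivity),
      ENNReal.ofReal_inv_of_pos (by positivity), ENNReal.ofReal_natCast]
  simp_rw [enorm_mul, mul_pow, hc]
  rw [lintegral_const_mul' _ _ (ENNReal.inv_ne_top.2 (natCast_ne_zero_of_neZero (n + 1)))]
  refine (mul_le_mul_right h _).trans (le_of_eq ?_)
  rw [← mul_assoc, ENNReal.inv_mul_cancel (natCast_ne_zero_of_neZero (n + 1))
    (ENNReal.natCast_ne_top _), one_mul]

lemma measurable_sample (hζ : ∀ i, Measurable (ζ i)) : Measurable fun ω j => ζ j ω :=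
  measurable_pi_lambda _ hζ

lemma measurable_sum_truncDiff (hU : Measurable U) (hζ : ∀ i, Measurable (ζ i)) (n : ℕ) :
    Measurable fun ω => (√((n + 1 : ℕ) : ℝ))⁻¹ * ∑ i ∈ Finset.range (n + 1),
      truncDiff U m₀ δ (hybrid m₀ (fun j => ζ j ω) (n + 1) i) (ζ i ω) :=
  (Finset.measurable_fun_sum _ fun i _ => (measurable_truncDiff hU).comp
    (((measurable_hybrid m₀ (n + 1) i).comp (measurable_sample hζ)).prodMk (hζ i))).const_mul _

end Truncation

/-- The deterministic estimate of the remainder of the linearization along the hybrid measures. -/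
lemma abs_sqrt_mul_sub_le {U : PMoment d l → ℝ} {m₀ : PMoment d l} (z : ℕ → Euc d) {n : ℕ} {α K : ℝ}
    (h : ∀ i < n + 1, |U (hybrid m₀ z (n + 1) (i + 1)) - U (hybrid m₀ z (n + 1) i) -
      ((n + 1 : ℕ) : ℝ)⁻¹ * centeredDeriv U m₀ (hybrid m₀ z (n + 1) i) (z i)| ≤
      (((n + 1 : ℕ) : ℝ)⁻¹) ^ (1 + α) * (K * (1 + ‖z i‖ ^ l +
        ∫ y, ‖y‖ ^ l ∂(m₀ : Measure (Euc d))))) :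
    |√((n + 1 : ℕ) : ℝ) * (U (empirical l z (n + 1)) - U m₀) -
      (√((n + 1 : ℕ) : ℝ))⁻¹ * ∑ i ∈ Finset.range (n + 1), centeredDeriv U m₀ m₀ (z i) -
      (√((n + 1 : ℕ) : ℝ))⁻¹ * ∑ i ∈ Finset.range (n + 1),
        derivDiff U m₀ (hybrid m₀ z (n + 1) i) (z i)| ≤
      ((n + 1 : ℕ) : ℝ) ^ (1 / 2 - α) * (K * ((1 + ∫ y, ‖y‖ ^ l ∂(m₀ : Measure (Euc d))) +
        (∑ i ∈ Finset.range (n + 1), ‖z i‖ ^ l) / (n + 1 : ℕ))) := by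
  set N : ℝ := ((n + 1 : ℕ) : ℝ) with hN
  have hN0 : 0 < N := by positivity
  set M := ∫ y, ‖y‖ ^ l ∂(m₀ : Measure (Euc d)) with hM
  have hs : √N * N⁻¹ = (√N)⁻¹ := by
    have := Real.sqrt_pos.2 hN0
    rw [← Real.sq_sqrt hN0.le, Real.sqrt_sq this.le]
    field_simp
  have htel : U (empirical l z (n + 1)) - U m₀ = ∑ i ∈ Finset.range (n + 1),
      (U (hybrid m₀ z (n + 1) (i + 1)) - U (hybrid m₀ z (n + 1) i)) := by
    rw [Finset.sum_range_sub (fun i => U (hybrid m₀ z (n + 1) i)), hybrid_zero, hybrid_self]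
  have heq : √N * (U (empirical l z (n + 1)) - U m₀) -
      (√N)⁻¹ * ∑ i ∈ Finset.range (n + 1), centeredDeriv U m₀ m₀ (z i) -
      (√N)⁻¹ * ∑ i ∈ Finset.range (n + 1), derivDiff U m₀ (hybrid m₀ z (n + 1) i) (z i) =
      √N * ∑ i ∈ Finset.range (n + 1), (U (hybrid m₀ z (n + 1) (i + 1)) -
        U (hybrid m₀ z (n + 1) i) - N⁻¹ * centeredDeriv U m₀ (hybrid m₀ z (n + 1) i) (z i)) := by
    simp only [derivDiff, Finset.sum_sub_distrib, ← Finset.mul_sum]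
    rw [htel, ← hs, Finset.sum_sub_distrib]
    ring
  -- The factor `N⁻¹` is kept aside to turn the sum of the moments into an average.
  have hp : √N * N⁻¹ ^ (1 + α) = N ^ (1 / 2 - α) * N⁻¹ := by
    rw [Real.sqrt_eq_rpow, Real.inv_rpow hN0.le, ← Real.rpow_neg hN0.le, ← Real.rpow_add hN0,
      ← Real.rpow_neg_one N, ← Real.rpow_add hN0]
    congr 1
    ring
  rw [heq, abs_mul, abs_of_nonneg (Real.sqrt_nonneg N)]
  calc √N * |∑ i ∈ Finset.range (n + 1), (U (hybrid m₀ z (n + 1) (i + 1)) -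
        U (hybrid m₀ z (n + 1) i) - N⁻¹ * centeredDeriv U m₀ (hybrid m₀ z (n + 1) i) (z i))|
      ≤ √N * ∑ i ∈ Finset.range (n + 1), N⁻¹ ^ (1 + α) * (K * (1 + ‖z i‖ ^ l + M)) := by
        refine mul_le_mul_of_nonneg_left ?_ (Real.sqrt_nonneg N)
        exact (Finset.abs_sum_le_sum_abs _ _).trans
          (Finset.sum_le_sum fun i hi => h i (Finset.mem_range.1 hi))
    _ = (√N * N⁻¹ ^ (1 + α)) * (K * (N * (1 + M) + ∑ i ∈ Finset.range (n + 1), ‖z i‖ ^ l)) := by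
        rw [← Finset.mul_sum, ← Finset.mul_sum, mul_assoc]
        congr 3
        simp only [Finset.sum_add_distrib, Finset.sum_const, Finset.card_range, nsmul_eq_mul, ← hN]
        ring
    _ = _ := by
        rw [hp]
        field_simp

end MeasureCLT

namespace MeasureCLT

/-! ### Assembling the central limit theorem -/

variable {d : ℕ} {l : ℝ} {m₀ : PMoment d l}

lemma exists_forall_distD_lt {T : PMoment d l → ℝ≥0∞} {p : ℝ} (hp : 0 < p)
    (hD : ∀ μ, distD m₀ μ m₀ = T μ ^ p) {η : ℝ≥0∞} (hη : 0 < η) :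
    ∃ η' : ℝ≥0∞, 0 < η' ∧ ∀ μ, T μ < η' → distD m₀ μ m₀ < η := by
  refine ⟨η ^ p⁻¹, ?_, fun μ hμ => ?_⟩
  · rw [ENNReal.lt_rpow_inv_iff hp, ENNReal.zero_rpow_of_pos hp]; exact hη
  · rw [hD, ← ENNReal.lt_rpow_inv_iff hp]; exact hμ

lemma self_mem_ballD {T : PMoment d l → ℝ≥0∞} {p : ℝ} (hp : 0 < p) (hT : IsGauge m₀ T)
    (hD : ∀ μ, distD m₀ μ m₀ = T μ ^ p) {r : ℝ} (hr : 0 < r) : m₀ ∈ ballD m₀ r := by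
  change distD m₀ m₀ m₀ < _
  rw [hD, hT.self, ENNReal.zero_rpow_of_pos hp]
  exact ENNReal.ofReal_pos.2 hr

lemma exists_forall_abs_sub_le {dU : PMoment d l → Euc d → ℝ}
    (h_cont : Tendsto
      (fun μ => ⨆ x, ENNReal.ofReal (|dU μ x - dU m₀ x| / (1 + ‖x‖ ^ (l / 2))))
      (comap (fun μ => distD m₀ μ m₀) (𝓝 0)) (𝓝 0)) {e : ℝ} (he : 0 < e) :
    ∃ η : ℝ≥0∞, 0 < η ∧ ∀ μ, distD m₀ μ m₀ < η →
      ∀ x, |dU μ x - dU m₀ x| ≤ e * (1 + ‖x‖ ^ (l / 2)) := by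
  have h := ENNReal.tendsto_nhds_zero.1 h_cont _ (ENNReal.ofReal_pos.2 he)
  obtain ⟨s, hs, hsub⟩ := Filter.mem_comap.1 h
  obtain ⟨η, hη, hη'⟩ := ENNReal.nhds_zero_basis.mem_iff.1 hs
  refine ⟨η, hη, fun μ hμ x => ?_⟩
  have h1 := hsub (show μ ∈ (fun μ => distD m₀ μ m₀) ⁻¹' s from hη' hμ)
  have h2 := (le_iSup (fun x => ENNReal.ofReal (|dU μ x - dU m₀ x| / (1 + ‖x‖ ^ (l / 2)))) x).trans
    h1
  rw [ENNReal.ofReal_le_ofReal_iff he.le, div_le_iff₀ (by positivity)] at h2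
  exact h2

lemma memLp_two_of_growth {f : Euc d → ℝ} (hf : Measurable f) {C : ℝ}
    (h : ∀ x, |f x| ≤ C * (1 + ‖x‖ ^ (l / 2))) : MemLp f 2 (m₀ : Measure (Euc d)) := by
  have h0 : MemLp (fun x => 1 + ‖x‖ ^ (l / 2)) 2 (m₀ : Measure (Euc d)) :=
    (memLp_const (1 : ℝ)).add (memLp_norm_rpow_half m₀)
  have h1 : MemLp (fun x => C * (1 + ‖x‖ ^ (l / 2))) 2 (m₀ : Measure (Euc d)) := h0.const_mul C
  refine h1.mono hf.aestronglyMeasurable (Eventually.of_forall fun x => ?_)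
  exact (h x).trans (le_abs_self _)

variable {Ω : Type*} [MeasurableSpace Ω] {P : Measure Ω} [IsProbabilityMeasure P]
  {ζ : ℕ → Ω → Euc d}

/-- The centering constant is the mean of `f (ζ 0)`, so this is the classical central limit theorem,
read along `n + 1`. -/
lemma tendstoInDistribution_sum_centeredDeriv (hζ : ∀ i, Measurable (ζ i)) (hind : iIndepFun ζ P)
    (hlaw : ∀ i, P.map (ζ i) = (m₀ : Measure (Euc d))) {U : PMoment d l → ℝ} {f : Euc d → ℝ}
    (hf : IsLinearFunctionalDerivAt U f m₀) (hL : MemLp (fun ω => f (ζ 0 ω)) 2 P) :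
    TendstoInDistribution (fun (n : ℕ) (ω : Ω) => (√((n + 1 : ℕ) : ℝ))⁻¹ *
      ∑ i ∈ Finset.range (n + 1), centeredDeriv U m₀ m₀ (ζ i ω)) atTop (id : ℝ → ℝ) (fun _ => P)
      (gaussianReal 0 (variance (fun ω => f (ζ 0 ω)) P).toNNReal) := by
  set c := ∫ y, f y ∂(m₀ : Measure (Euc d)) with hc
  have hid : ∀ i, IdentDistrib (ζ i) (ζ 0) P P := fun i =>
    ⟨(hζ i).aemeasurable, (hζ 0).aemeasurable, by rw [hlaw, hlaw]⟩
  have hmean : P[fun ω => f (ζ 0 ω)] = c := by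
    rw [hc, ← hlaw 0, integral_map (hζ 0).aemeasurable hf.1.aestronglyMeasurable]
  have h := tendstoInDistribution_inv_sqrt_mul_sum_sub (P := P) (X := fun i ω => f (ζ i ω))
    (Y := (id : ℝ → ℝ)) (P' := gaussianReal 0 (variance (fun ω => f (ζ 0 ω)) P).toNNReal)
    HasLaw.id hL (hind.comp (fun _ => f) fun _ => hf.1) (fun i => (hid i).comp hf.1)
  have h' : TendstoInDistribution (fun (n : ℕ) (ω : Ω) => (√((n + 1 : ℕ) : ℝ))⁻¹ *
      (∑ i ∈ Finset.range (n + 1), f (ζ i ω) - (n + 1 : ℕ) * P[fun ω => f (ζ 0 ω)])) atTop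
      (id : ℝ → ℝ) (fun _ => P)
      (gaussianReal 0 (variance (fun ω => f (ζ 0 ω)) P).toNNReal) :=
    ⟨fun n => h.forall_aemeasurable (n + 1), h.aemeasurable_limit,
      h.tendsto.comp (tendsto_add_atTop_nat 1)⟩
  refine h'.congr (fun n => Eventually.of_forall fun ω => ?_) (EventuallyEq.refl _ _)
  simp only [centeredDeriv_eq hf, Finset.sum_sub_distrib, Finset.sum_const, Finset.card_range,
    nsmul_eq_mul, hmean, ← hc]

lemma measurable_empirical_comp (m₀ : PMoment d l) {U : PMoment d l → ℝ} (hU : Measurable U)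
    (hζ : ∀ i, Measurable (ζ i)) (n : ℕ) :
    Measurable fun ω => U (empirical l (fun i => ζ i ω) (n + 1)) := by
  have h := hU.comp ((measurable_hybrid m₀ (n + 1) (n + 1)).comp (measurable_sample hζ))
  simpa only [Function.comp_def, hybrid_self] using h

theorem centralLimit_of_measurable (hl : 0 ≤ l) (hζ : ∀ i, Measurable (ζ i)) (hind : iIndepFun ζ P)
    (hlaw : ∀ i, P.map (ζ i) = (m₀ : Measure (Euc d)))
    {U : PMoment d l → ℝ} (hU : Measurable U) {dU : PMoment d l → Euc d → ℝ} {r : ℝ} (hr : 0 < r)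
    (h_deriv : ∀ μ ∈ ballD m₀ r, IsLinearFunctionalDerivAt U (dU μ) μ)
    (h_growth : ∃ C : ℝ, ∀ μ ∈ ballD m₀ r, ∀ x, |dU μ x| ≤ C * (1 + ‖x‖ ^ (l / 2)))
    (h_holder : ∃ α : ℝ, 1 / 2 < α ∧ α ≤ 1 ∧ ∃ C : ℝ, ∀ μ₁ ∈ ballD m₀ r, ∀ μ₂ ∈ ballD m₀ r, ∀ x,
        |dU μ₂ x - dU μ₁ x| ≤ C * ((1 + ‖x‖ ^ l) *
          (wassersteinZero (μ₂ : Measure (Euc d)) (μ₁ : Measure (Euc d))).toReal ^ α +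
          (1 + ‖x‖ ^ (l * (1 - α))) *
            (∫ y, ‖y‖ ^ l ∂(absDiff (μ₂ : Measure (Euc d)) (μ₁ : Measure (Euc d)))) ^ α))
    (h_cont : Tendsto
      (fun μ => ⨆ x, ENNReal.ofReal (|dU μ x - dU m₀ x| / (1 + ‖x‖ ^ (l / 2))))
      (comap (fun μ => distD m₀ μ m₀) (𝓝 0)) (𝓝 0)) :
    MemLp (fun ω => dU m₀ (ζ 0 ω)) 2 P ∧
    TendstoInDistribution
      (fun (n : ℕ) (ω : Ω) =>
        √((n + 1 : ℕ) : ℝ) * (U (empirical l (fun i => ζ i ω) (n + 1)) - U m₀))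
      atTop (id : ℝ → ℝ) (fun _ => P)
      (gaussianReal 0 (variance (fun ω => dU m₀ (ζ 0 ω)) P).toNNReal) := by
  obtain ⟨T, p, hp, hT, hD⟩ := exists_isGauge hl m₀
  have hm₀ : m₀ ∈ ballD m₀ r := self_mem_ballD hp hT hD hr
  have hf := h_deriv m₀ hm₀
  obtain ⟨Cg, hCg⟩ := h_growth
  obtain ⟨α, hα, hα1, C, hC⟩ := h_holder
  have hLm := memLp_two_of_growth (m₀ := m₀) hf.1 (hCg m₀ hm₀)
  have hL : MemLp (fun ω => dU m₀ (ζ 0 ω)) 2 P := by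
    rw [← hlaw 0] at hLm
    exact (memLp_map_measure_iff hf.1.aestronglyMeasurable (hζ 0).aemeasurable).1 hLm
  refine ⟨hL, ?_⟩
  have hUm : ∀ n, Measurable fun ω => √((n + 1 : ℕ) : ℝ) *
      (U (empirical l (fun i => ζ i ω) (n + 1)) - U m₀) := fun n =>
    ((measurable_empirical_comp m₀ hU hζ n).sub_const _).const_mul _
  have hGm : Measurable (centeredDeriv U m₀ m₀) := (measurable_centeredDeriv hU m₀).of_uncurry_left
  -- Slutsky: the difference from the i.i.d. sum only has to vanish in probability.
  refine tendstoInDistribution_of_tendstoInMeasure_sub _ _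
    (tendstoInDistribution_sum_centeredDeriv hζ hind hlaw hf hL) ?_ fun n => (hUm n).aemeasurable
  refine tendstoInMeasure_zero_of_forall_approx (fun n => (hUm n).sub
    ((Finset.measurable_fun_sum _ fun i _ => hGm.comp (hζ i)).const_mul _)) fun δ hδ hδtop => ?_
  refine ⟨fun n ω => (√((n + 1 : ℕ) : ℝ))⁻¹ * ∑ i ∈ Finset.range (n + 1),
      truncDiff U m₀ δ (hybrid m₀ (fun j => ζ j ω) (n + 1) i) (ζ i ω),
    fun n => measurable_sum_truncDiff hU hζ n,
    fun n => lintegral_sum_truncDiff_le hU hδtop hζ hind hlaw n, ?_⟩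
  obtain ⟨e, he, hgood⟩ := exists_forall_mem_goodSet h_deriv hm₀ hδ
  obtain ⟨η₁, hη₁, hη₁'⟩ := exists_forall_abs_sub_le h_cont he
  -- Below the gauge level `η` a measure lies both in the ball of the hypotheses and in the good set
  -- for `δ`.
  obtain ⟨η, hη, hη'⟩ := exists_forall_distD_lt hp hD (lt_min hη₁ (ENNReal.ofReal_pos.2 hr))
  have hball : ∀ μ, T μ < η → μ ∈ ballD m₀ r := fun μ hμ => (lt_min_iff.1 (hη' μ hμ)).2
  have hgood' : ∀ μ, T μ < η → μ ∈ goodSet U m₀ δ := fun μ hμ =>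
    hgood μ (hball μ hμ) (hη₁' μ (lt_min_iff.1 (hη' μ hμ)).1)
  set M := ∫ y, ‖y‖ ^ l ∂(m₀ : Measure (Euc d)) with hM
  have hlm : Measurable fun x : Euc d => ‖x‖ ^ l := by fun_prop
  filter_upwards [hT.ae_tendsto_empirical hζ hind hlaw,
    ae_tendsto_average hζ hind hlaw hlm m₀.2.2] with ω hω1 hω2
  have hbound : ∀ᶠ n : ℕ in atTop,
      |√((n + 1 : ℕ) : ℝ) * (U (empirical l (fun j => ζ j ω) (n + 1)) - U m₀) -
      (√((n + 1 : ℕ) : ℝ))⁻¹ * ∑ i ∈ Finset.range (n + 1), centeredDeriv U m₀ m₀ (ζ i ω) -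
      (√((n + 1 : ℕ) : ℝ))⁻¹ * ∑ i ∈ Finset.range (n + 1),
        truncDiff U m₀ δ (hybrid m₀ (fun j => ζ j ω) (n + 1) i) (ζ i ω)| ≤
      ((n + 1 : ℕ) : ℝ) ^ (1 / 2 - α) * ((|C| * (6 + M)) * ((1 + M) +
        (∑ i ∈ Finset.range (n + 1), ‖ζ i ω‖ ^ l) / (n + 1 : ℕ))) := by
    filter_upwards [hT.eventually_forall_hybrid_lt hω1 hη] with n hn
    have htr : ∑ i ∈ Finset.range (n + 1),
        truncDiff U m₀ δ (hybrid m₀ (fun j => ζ j ω) (n + 1) i) (ζ i ω) =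
        ∑ i ∈ Finset.range (n + 1),
          derivDiff U m₀ (hybrid m₀ (fun j => ζ j ω) (n + 1) i) (ζ i ω) := by
      refine Finset.sum_congr rfl fun i hi => ?_
      rw [truncDiff, if_pos (hgood' _ (hn i (Finset.mem_range.1 hi).le))]
    rw [htr]
    refine abs_sqrt_mul_sub_le (fun j => ζ j ω) fun i hi => ?_
    obtain ⟨κ, _, h1, h2⟩ := exists_hybrid_eq_add m₀ (fun j => ζ j ω) hi
    refine abs_sub_sub_centeredDeriv_le m₀ h_deriv (by linarith) hα1 hC (by positivity) h1 h2
      fun s => hball _ ?_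
    -- Convexity of the sublevel sets of `T` keeps the whole segment between consecutive hybrids in
    -- the ball.
    exact (hT.mix_le_max _ _ s).trans_lt (max_lt (hn i hi.le) (hn (i + 1) hi))
  refine squeeze_zero_norm' hbound ?_
  have h1 : Tendsto (fun n : ℕ => ((n + 1 : ℕ) : ℝ) ^ (1 / 2 - α)) atTop (𝓝 0) := by
    have h := (tendsto_rpow_neg_atTop (sub_pos.2 hα)).comp
      (tendsto_natCast_atTop_atTop.comp (tendsto_add_atTop_nat 1))
    simpa [Function.comp_def] using h
  -- The average of `‖ζ i‖ ^ l` converges by the strong law, hence is bounded, while the power of `n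
  -- + 1` tends to zero.
  have h2 := h1.mul (((hω2.comp (tendsto_add_atTop_nat 1)).const_add (1 + M)).const_mul
    (|C| * (6 + M)))
  rw [zero_mul] at h2
  exact h2

end MeasureCLT

theorem mainTheorem2 {d : ℕ} {l : ℝ} (hl : 0 ≤ l) (m₀ : MeasureCLT.PMoment d l)
    {Ω : Type*} [MeasurableSpace Ω] (P : Measure Ω) [IsProbabilityMeasure P]
    (ζ : ℕ → Ω → MeasureCLT.Euc d)
    (hζ_law : ∀ i, HasLaw (ζ i) (m₀ : Measure (MeasureCLT.Euc d)) P)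
    (hζ_indep : iIndepFun ζ P)
    (U : MeasureCLT.PMoment d l → ℝ) (hU : Measurable U)
    (dU : MeasureCLT.PMoment d l → MeasureCLT.Euc d → ℝ)
    (r : ℝ) (hr : 0 < r)
    (h_deriv : ∀ μ ∈ MeasureCLT.ballD m₀ r, MeasureCLT.IsLinearFunctionalDerivAt U (dU μ) μ)
    (h_growth : ∃ C : ℝ, ∀ μ ∈ MeasureCLT.ballD m₀ r, ∀ x, |dU μ x| ≤ C * (1 + ‖x‖ ^ (l / 2)))
    (h_holder : ∃ α : ℝ, 1 / 2 < α ∧ α ≤ 1 ∧ ∃ C : ℝ,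
      ∀ μ₁ ∈ MeasureCLT.ballD m₀ r, ∀ μ₂ ∈ MeasureCLT.ballD m₀ r, ∀ x,
        |dU μ₂ x - dU μ₁ x| ≤
          C * ((1 + ‖x‖ ^ l) *
                (MeasureCLT.wassersteinZero (μ₂ : Measure (MeasureCLT.Euc d))
                  (μ₁ : Measure (MeasureCLT.Euc d))).toReal ^ α
              + (1 + ‖x‖ ^ (l * (1 - α))) *
                (∫ y, ‖y‖ ^ l ∂(MeasureCLT.absDiff (μ₂ : Measure (MeasureCLT.Euc d))
                  (μ₁ : Measure (MeasureCLT.Euc d)))) ^ α))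
    (h_cont : Tendsto
      (fun μ => ⨆ x, ENNReal.ofReal (|dU μ x - dU m₀ x| / (1 + ‖x‖ ^ (l / 2))))
      (comap (fun μ => MeasureCLT.distD m₀ μ m₀) (𝓝 0)) (𝓝 0)) :
    MemLp (fun ω => dU m₀ (ζ 0 ω)) 2 P ∧
    TendstoInDistribution
      (fun (n : ℕ) (ω : Ω) =>
        √((n + 1 : ℕ) : ℝ) * (U (MeasureCLT.empirical l (fun i => ζ i ω) (n + 1)) - U m₀))
      atTop (id : ℝ → ℝ) (fun _ => P)
      (gaussianReal 0 (variance (fun ω => dU m₀ (ζ 0 ω)) P).toNNReal) := by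
  -- A law in the sense of `HasLaw` gives only almost everywhere measurability; countably many
  -- measurable modifications agree with the sample on one almost sure event.
  set ζ' : ℕ → Ω → MeasureCLT.Euc d := fun i => (hζ_law i).aemeasurable.mk (ζ i) with hζ'
  have hae : ∀ i, ζ i =ᵐ[P] ζ' i := fun i => (hζ_law i).aemeasurable.ae_eq_mk
  have hlaw : ∀ i, P.map (ζ' i) = (m₀ : Measure (MeasureCLT.Euc d)) := fun i =>
    (Measure.map_congr (hae i)).symm.trans (hζ_law i).map_eq
  obtain ⟨h1, h2⟩ := MeasureCLT.centralLimit_of_measurable hl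
    (fun i => (hζ_law i).aemeasurable.measurable_mk) (hζ_indep.congr hae) hlaw hU hr h_deriv
    h_growth h_holder h_cont
  have hd : (fun ω => dU m₀ (ζ' 0 ω)) =ᵐ[P] fun ω => dU m₀ (ζ 0 ω) :=
    (hae 0).symm.fun_comp (dU m₀)
  rw [variance_congr hd] at h2
  refine ⟨h1.ae_eq hd, h2.congr (fun n => ?_) (EventuallyEq.refl _ _)⟩
  filter_upwards [ae_all_iff.2 hae] with ω hω
  rw [show (fun i => ζ i ω) = fun i => ζ' i ω from funext hω]
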